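/- Write $\mathbb{R}_+=[0,\infty)$ and $\mathbb{N}=\{1,2,\dots\}$. Let $\nu,\mu$ be Borel probability measures on $\mathbb{R}_+$ and let $\xi=(\xi_\ell)_{\ell\in\mathbb{N}}$ be an $\mathbb{R}_+$-valued stochastic process such that $\xi_\ell\stackrel{d}{=}\nu$ for all $\ell\in\mathbb{N}$ and $(\xi_\ell,\xi_k)\stackrel{d}{=}(\xi_{\ell+\tau},\xi_{k+\tau})$ for all $\ell,k,\tau\in\mathbb{N}$. For $n\in\mathbb{N}$ let $$\alpha_n=\sup\bigl\{|\mathbb{P}(A\cap B)-\mathbb{P}(A)\mathbb{P}(B)| : k\in\mathbb{N},\ A\in\sigma(\xi_1,\dots,\xi_k),\ B\in\sigma(\xi_{k+n},\xi_{k+n+1},\dots)\bigr\},$$ and assume that $\sum_{n\ge1}\alpha_n<\infty$ and that there are integer sequences $p=p(n)$, $q=q(n)$ such that, as $n\to\infty$, $p\to\infty$, $q\to\infty$, $q=o(p)$, $p=o(n)$, $n p^{-1}\alpha_q=o(1)$ and $\frac pn\sum_{j=1}^p j\alpha_j=o(1)$. Let $g:\mathbb{R}_+^2\to\mathbb{R}$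 be bounded and measurable. Let $V$ have law $\nu$ and let $U,U'$ have law $\mu$, with $V,U,U'$ independent and $(U,U')$ independent of $\xi$, and put $\tilde g(x,y)=g(x,y)-\mathbb{E}[g(V,y)]$. Then the quantity $$\rho_g^2=\mathbb{E}\bigl[\tilde g(V,U)^2\bigr]+2\sum_{k=1}^\infty\mathbb{E}\bigl[\tilde g(\xi_1,U)\,\tilde g(\xi_{1+k},U')\bigr]$$ is finite (the series converges absolutely) and nonnegative. Moreover, for $\mu^{\mathbb{N}}$-almost every sequence $(s_i)_{i\in\mathbb{N}}\in\mathbb{R}_+^{\mathbb{N}}$, $$\frac{\sum_{j=1}^{2n-1}\tilde g(\xi_j,s_j)}{\sqrt{2n}}\xrightarrow{d}\mathcal{N}(0,\rho_g^2)\qquad\text{as } n\to\infty,$$ where $\mathcal{N}(0,0)$ is the Dirac mass at $0$. -/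

import Mathlib

open MeasureTheory ProbabilityTheory Filter Topology Asymptotics
open scoped NNReal

/- Throughout, sequences are indexed from `1`: a process is a map `ξ : ℕ → Ω → ℝ≥0` of which only
the variables `ξ 1, ξ 2, …` are ever used (the value at index `0` is a dummy). -/

namespace QuenchedCLT

noncomputable section

/-- The random variables `ξ 1, ξ 2, …` all have law `ν`, and the joint law of a pair
`(ξ ℓ, ξ k)` is invariant under a common shift of the two times. -/
structure IsPairStationary {Ω : Type*} [MeasurableSpace Ω] (P : Measure Ω)
    (ν : Measure ℝ≥0) (ξ : ℕ → Ω → ℝ≥0) : Prop where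
  measurable : ∀ ℓ, 1 ≤ ℓ → Measurable (ξ ℓ)
  law_eq : ∀ ℓ, 1 ≤ ℓ → P.map (ξ ℓ) = ν
  pair_law_eq : ∀ ℓ k τ, 1 ≤ ℓ → 1 ≤ k → 1 ≤ τ →
    P.map (fun ω => (ξ ℓ ω, ξ k ω)) = P.map (fun ω => (ξ (ℓ + τ) ω, ξ (k + τ) ω))

/-- The σ-algebra generated by `ξ 1, …, ξ k`. -/
def pastSigma {Ω : Type*} (ξ : ℕ → Ω → ℝ≥0) (k : ℕ) : MeasurableSpace Ω :=
  ⨆ i ∈ Set.Icc 1 k, MeasurableSpace.comap (ξ i) inferInstance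

/-- The σ-algebra generated by `ξ k, ξ (k+1), …`. -/
def futureSigma {Ω : Type*} (ξ : ℕ → Ω → ℝ≥0) (k : ℕ) : MeasurableSpace Ω :=
  ⨆ i ∈ Set.Ici k, MeasurableSpace.comap (ξ i) inferInstance

/-- The strong mixing coefficient: the supremum of `|P(A ∩ B) - P(A) P(B)|` over `k ≥ 1`,
`A ∈ σ(ξ 1, …, ξ k)` and `B ∈ σ(ξ (k+n), ξ (k+n+1), …)`. -/
def alpha {Ω : Type*} [MeasurableSpace Ω] (P : Measure Ω) (ξ : ℕ → Ω → ℝ≥0) (n : ℕ) : ℝ :=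
  sSup {r : ℝ | ∃ k : ℕ, 1 ≤ k ∧ ∃ A B : Set Ω,
    MeasurableSet[pastSigma ξ k] A ∧ MeasurableSet[futureSigma ξ (k + n)] B ∧
      r = |P.real (A ∩ B) - P.real A * P.real B|}

/-- Admissible lengths `p n` of the big blocks and `q n` of the small blocks, for mixing
coefficients `a`. -/
structure IsBlockPair (a : ℕ → ℝ) (p q : ℕ → ℕ) : Prop where
  p_tendsto : Tendsto p atTop atTop
  q_tendsto : Tendsto q atTop atTop
  q_isLittleO : (fun n => (q n : ℝ)) =o[atTop] (fun n => (p n : ℝ))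
  p_isLittleO : (fun n => (p n : ℝ)) =o[atTop] (fun n : ℕ => (n : ℝ))
  mixing_q : Tendsto (fun n : ℕ => (n : ℝ) * (p n : ℝ)⁻¹ * a (q n)) atTop (𝓝 0)
  mixing_p : Tendsto
    (fun n : ℕ => (p n : ℝ) / (n : ℝ) * ∑ j ∈ Finset.Icc 1 (p n), (j : ℝ) * a j) atTop (𝓝 0)

/-- The centered function `g̃ (x, y) = g (x, y) - E[g (V, y)]`, where `V` has law `ν`. -/
def centered (ν : Measure ℝ≥0) (g : ℝ≥0 × ℝ≥0 → ℝ) (z : ℝ≥0 × ℝ≥0) : ℝ :=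
  g z - ∫ v, g (v, z.2) ∂ν

/-- The random variable `g̃ (ξ 1, U) * g̃ (ξ (1+k), U')`, where `U`, `U'` are the two coordinates of
the second factor of `Ω × (ℝ≥0 × ℝ≥0)`. -/
def corrVar {Ω : Type*} (ν : Measure ℝ≥0) (ξ : ℕ → Ω → ℝ≥0)
    (g : ℝ≥0 × ℝ≥0 → ℝ) (k : ℕ) (w : Ω × (ℝ≥0 × ℝ≥0)) : ℝ :=
  centered ν g (ξ 1 w.1, w.2.1) * centered ν g (ξ (1 + k) w.1, w.2.2)

/-- `E[g̃ (ξ 1, U) g̃ (ξ (1+k), U')]`, where `U`, `U'` have law `μ` and `U`, `U'`, `ξ` are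
independent. -/
def corr {Ω : Type*} [MeasurableSpace Ω] (P : Measure Ω) (ν μ : Measure ℝ≥0)
    (ξ : ℕ → Ω → ℝ≥0) (g : ℝ≥0 × ℝ≥0 → ℝ) (k : ℕ) : ℝ :=
  ∫ w, corrVar ν ξ g k w ∂(P.prod (μ.prod μ))

/-- The limiting variance `E[g̃ (V, U)²] + 2 ∑_{k ≥ 1} E[g̃ (ξ 1, U) g̃ (ξ (1+k), U')]`, where `V`
has law `ν` and `U` has law `μ`, independent of `V`. -/
def rhoSq {Ω : Type*} [MeasurableSpace Ω] (P : Measure Ω) (ν μ : Measure ℝ≥0)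
    (ξ : ℕ → Ω → ℝ≥0) (g : ℝ≥0 × ℝ≥0 → ℝ) : ℝ :=
  (∫ z, centered ν g z ^ 2 ∂(ν.prod μ)) + 2 * ∑' k : ℕ, corr P ν μ ξ g (k + 1)

end

end QuenchedCLT

/-!
The characteristic function of the partial sums is expanded one variable at a time, always towards
the past. Together with the covariance inequality for strongly mixing variables this gives the
central limit theorem from the summability of the mixing coefficients alone, so that no
decomposition into blocks is needed. For almost every sample of the parameters, the variances of
the partial sums converge by the strong law of large numbers, applied to the averages of the
covariances at each lag.
-/

namespace QuenchedCLT

section Covariance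

variable {Ω : Type*} {mΩ : MeasurableSpace Ω} {P : Measure Ω}
  {E : Type*} [NormedAddCommGroup E] [NormedSpace ℝ E]

lemma integral_norm_condExp_le_of_setIntegral_le [IsFiniteMeasure P] {m : MeasurableSpace Ω}
    (hm : m ≤ mΩ) {W : Ω → ℝ} (hW : Integrable W P) {c : ℝ}
    (hc : ∀ S, MeasurableSet[m] S → |∫ ω in S, W ω ∂P| ≤ c) :
    ∫ ω, ‖P[W | m] ω‖ ∂P ≤ 2 * c := by
  have hpos : MeasurableSet[m] {ω | 0 ≤ P[W | m] ω} :=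
    stronglyMeasurable_condExp.measurable measurableSet_Ici
  rw [← integral_add_compl (hm _ hpos) integrable_condExp.norm,
    setIntegral_congr_fun (g := P[W | m]) (hm _ hpos) fun ω hω => Real.norm_of_nonneg hω,
    setIntegral_congr_fun (g := fun ω => -P[W | m] ω) (hm _ hpos.compl)
      fun ω hω => Real.norm_of_nonpos (by simpa using hω : P[W | m] ω < 0).le,
    integral_neg, setIntegral_condExp hm hW hpos, setIntegral_condExp hm hW hpos.compl]
  linarith [(abs_le.1 (hc _ hpos)).2, (abs_le.1 (hc _ hpos.compl)).1]

lemma norm_integral_smul_le_of_setIntegral_le [IsProbabilityMeasure P] [CompleteSpace E]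
    {m : MeasurableSpace Ω} (hm : m ≤ mΩ) {W : Ω → ℝ} (hW : Integrable W P) {Y : Ω → E}
    (hY : StronglyMeasurable[m] Y) {a c : ℝ} (hYa : ∀ ω, ‖Y ω‖ ≤ a)
    (hc : ∀ S, MeasurableSet[m] S → |∫ ω in S, W ω ∂P| ≤ c) :
    ‖∫ ω, W ω • Y ω ∂P‖ ≤ 2 * a * c := by
  have ha : 0 ≤ a := by
    obtain ⟨ω⟩ := nonempty_of_isProbabilityMeasure P
    exact (norm_nonneg _).trans (hYa ω)
  have hWY : Integrable (W • Y) P :=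
    hW.smul_bdd a (hY.mono hm).aestronglyMeasurable (ae_of_all _ hYa)
  have hpull : P[W • Y | m] =ᵐ[P] P[W | m] • Y :=
    condExp_smul_of_aestronglyMeasurable_right hW hWY hY.aestronglyMeasurable
  calc ‖∫ ω, W ω • Y ω ∂P‖ = ‖∫ ω, P[W | m] ω • Y ω ∂P‖ :=
        congrArg norm ((integral_condExp hm).symm.trans (integral_congr_ae hpull))
    _ ≤ ∫ ω, ‖P[W | m] ω‖ * a ∂P := by
        refine norm_integral_le_of_norm_le (integrable_condExp.norm.mul_const a)
          (ae_of_all _ fun ω => ?_)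
        rw [norm_smul]
        exact mul_le_mul_of_nonneg_left (hYa ω) (norm_nonneg _)
    _ ≤ 2 * c * a := by
        rw [integral_mul_const]
        gcongr
        exact integral_norm_condExp_le_of_setIntegral_le hm hW hc
    _ = 2 * a * c := by ring

lemma setIntegral_sub_integral [IsFiniteMeasure P] {Z : Ω → ℝ} (hZ : Integrable Z P) {S : Set Ω}
    (hS : MeasurableSet S) :
    ∫ ω in S, (Z ω - ∫ ω', Z ω' ∂P) ∂P = ∫ ω, (S.indicator 1 ω - P.real S) • Z ω ∂P := by
  have hind : (fun ω => S.indicator (1 : Ω → ℝ) ω * Z ω) = S.indicator Z := by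
    ext ω; by_cases h : ω ∈ S <;> simp [h]
  simp only [smul_eq_mul, sub_mul]
  rw [integral_sub hZ.integrableOn (integrable_const _).integrableOn, setIntegral_const,
    integral_sub (by rw [hind]; exact hZ.indicator hS) (hZ.const_mul _), integral_const_mul, hind,
    integral_indicator hS, smul_eq_mul]

lemma norm_integral_smul_sub_le [IsProbabilityMeasure P] [CompleteSpace E]
    {m₁ m₂ : MeasurableSpace Ω} (h₁ : m₁ ≤ mΩ) (h₂ : m₂ ≤ mΩ) {α a c : ℝ}
    (hα : ∀ A B, MeasurableSet[m₁] A → MeasurableSet[m₂] B →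
      |P.real (A ∩ B) - P.real A * P.real B| ≤ α)
    {Y : Ω → E} (hY : StronglyMeasurable[m₁] Y) (hYa : ∀ ω, ‖Y ω‖ ≤ a)
    {Z : Ω → ℝ} (hZ : StronglyMeasurable[m₂] Z) (hZc : ∀ ω, |Z ω| ≤ c) :
    ‖∫ ω, Z ω • Y ω ∂P - (∫ ω, Z ω ∂P) • ∫ ω, Y ω ∂P‖ ≤ 4 * a * c * α := by
  have hZi : Integrable Z P := .of_bound (hZ.mono h₂).aestronglyMeasurable c (ae_of_all _ hZc)
  have hYi : Integrable Y P := .of_bound (hY.mono h₁).aestronglyMeasurable a (ae_of_all _ hYa)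
  have hind : ∀ S, MeasurableSet[m₁] S → ∀ T, MeasurableSet[m₂] T →
      |∫ ω in T, (S.indicator 1 ω - P.real S) ∂P| ≤ α := by
    intro S hS T hT
    rw [integral_sub (f := S.indicator 1)
      ((integrable_const (1 : ℝ)).indicator (h₁ _ hS)).integrableOn
      (integrable_const _).integrableOn, setIntegral_const, integral_indicator_one (h₁ _ hS),
      measureReal_restrict_apply (h₁ _ hS), smul_eq_mul, mul_comm (P.real T)]
    exact hα S T hS hT
  have hset : ∀ S, MeasurableSet[m₁] S →
      |∫ ω in S, (Z ω - ∫ ω', Z ω' ∂P) ∂P| ≤ 2 * c * α := by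
    intro S hS
    rw [setIntegral_sub_integral hZi (h₁ _ hS)]
    exact norm_integral_smul_le_of_setIntegral_le h₂
      (((integrable_const (1 : ℝ)).indicator (h₁ _ hS)).sub (integrable_const _)) hZ hZc (hind S hS)
  have hcov : ∫ ω, Z ω • Y ω ∂P - (∫ ω, Z ω ∂P) • ∫ ω, Y ω ∂P
      = ∫ ω, (Z ω - ∫ ω', Z ω' ∂P) • Y ω ∂P := by
    simp only [sub_smul]
    have hZY : Integrable (fun ω => Z ω • Y ω) P :=
      hZi.smul_bdd a hYi.aestronglyMeasurable (ae_of_all _ hYa)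
    have hEY : Integrable (fun ω => (∫ ω', Z ω' ∂P) • Y ω) P := hYi.smul _
    rw [integral_sub hZY hEY, integral_smul]
  calc _ = ‖∫ ω, (Z ω - ∫ ω', Z ω' ∂P) • Y ω ∂P‖ := by rw [hcov]
    _ ≤ 2 * a * (2 * c * α) :=
        norm_integral_smul_le_of_setIntegral_le h₁ (hZi.sub (integrable_const _)) hY hYa hset
    _ = 4 * a * c * α := by ring

end Covariance

section ExpSum

variable {Ω : Type*} {X : ℕ → Ω → ℝ} {K u : ℝ}

/-- The random variable `exp (i u (X 0 + ⋯ + X (k - 1)))`, whose expectation is the characteristic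
function at `u` of the `k`-th partial sum of `X`. -/
noncomputable def expSum (X : ℕ → Ω → ℝ) (u : ℝ) (k : ℕ) (ω : Ω) : ℂ :=
  Complex.exp ((u * ∑ j ∈ Finset.range k, X j ω : ℝ) * Complex.I)

lemma norm_expSum (X : ℕ → Ω → ℝ) (u : ℝ) (k : ℕ) (ω : Ω) : ‖expSum X u k ω‖ = 1 :=
  Complex.norm_exp_ofReal_mul_I _

lemma expSum_zero (X : ℕ → Ω → ℝ) (u : ℝ) (ω : Ω) : expSum X u 0 ω = 1 := by
  simp [expSum]

lemma expSum_succ (X : ℕ → Ω → ℝ) (u : ℝ) (k : ℕ) (ω : Ω) :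
    expSum X u (k + 1) ω = expSum X u k ω * Complex.exp ((u * X k ω : ℝ) * Complex.I) := by
  rw [expSum, expSum, ← Complex.exp_add, Finset.sum_range_succ]
  push_cast
  ring_nf

lemma measurable_expSum {m : MeasurableSpace Ω} (u : ℝ) {k : ℕ} (hX : ∀ j < k, Measurable (X j)) :
    Measurable (expSum X u k) := by
  have hS : Measurable fun ω => ∑ j ∈ Finset.range k, X j ω :=
    Finset.measurable_fun_sum _ fun j hj => hX j (Finset.mem_range.1 hj)
  exact Complex.measurable_exp.comp
    ((Complex.measurable_ofReal.comp (hS.const_mul u)).mul_const Complex.I)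

lemma norm_exp_mul_I_sub_taylor_one_le {x : ℝ} (hx : |x| ≤ 1) :
    ‖Complex.exp (x * Complex.I) - 1 - x * Complex.I‖ ≤ |x| ^ 2 := by
  simpa using Complex.norm_exp_sub_one_sub_id_le (x := x * Complex.I) (by simpa using hx)

lemma norm_exp_mul_I_sub_taylor_two_le {x : ℝ} (hx : |x| ≤ 1) :
    ‖Complex.exp (x * Complex.I) - 1 - x * Complex.I + x ^ 2 / 2‖ ≤ |x| ^ 3 := by
  have h := Complex.exp_bound (x := x * Complex.I) (by simpa using hx) (n := 3) (by norm_num)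
  have hsum : Complex.exp (x * Complex.I)
      - ∑ m ∈ Finset.range 3, (x * Complex.I) ^ m / (m.factorial : ℂ)
      = Complex.exp (x * Complex.I) - 1 - x * Complex.I + x ^ 2 / 2 := by
    simp only [Finset.sum_range_succ, Finset.sum_range_zero, mul_pow, Complex.I_sq, Nat.factorial]
    push_cast
    ring
  rw [hsum, norm_mul, Complex.norm_I, mul_one, Complex.norm_real, Real.norm_eq_abs] at h
  refine h.trans (mul_le_of_le_one_right (by positivity) ?_)
  norm_num [Nat.factorial]

variable (hX : ∀ k ω, |X k ω| ≤ K)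
include hX

lemma abs_mul_le_mul_bound (u : ℝ) (k : ℕ) (ω : Ω) : |u * X k ω| ≤ |u| * K := by
  rw [abs_mul]
  exact mul_le_mul_of_nonneg_left (hX k ω) (abs_nonneg u)

lemma norm_expSum_sub_le (u : ℝ) {k l : ℕ} (hkl : k ≤ l) (ω : Ω) :
    ‖expSum X u l ω - expSum X u k ω‖ ≤ |u| * K * (l - k : ℕ) := by
  induction l, hkl using Nat.le_induction with
  | base => simp
  | succ l hkl ih =>
    have hsucc : ‖expSum X u (l + 1) ω - expSum X u l ω‖ ≤ |u| * K := by
      rw [expSum_succ, ← mul_sub_one, norm_mul, norm_expSum, one_mul, mul_comm _ Complex.I]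
      exact Real.norm_exp_I_mul_ofReal_sub_one_le.trans (abs_mul_le_mul_bound hX u l ω)
    calc _ ≤ ‖expSum X u (l + 1) ω - expSum X u l ω‖ + ‖expSum X u l ω - expSum X u k ω‖ :=
          norm_sub_le_norm_sub_add_norm_sub _ _ _
      _ ≤ |u| * K + |u| * K * (l - k : ℕ) := add_le_add hsucc ih
      _ = _ := by rw [Nat.succ_sub hkl]; push_cast; ring

lemma norm_expSum_succ_sub_taylor_one_le (hu : |u| * K ≤ 1) (k : ℕ) (ω : Ω) :
    ‖expSum X u (k + 1) ω - expSum X u k ω - (u * Complex.I) * (X k ω • expSum X u k ω)‖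
      ≤ (|u| * K) ^ 2 := by
  have hux := abs_mul_le_mul_bound hX u k ω
  calc _ = ‖expSum X u k ω * (Complex.exp ((u * X k ω : ℝ) * Complex.I) - 1
        - (u * X k ω : ℝ) * Complex.I)‖ := by
        rw [expSum_succ, Complex.real_smul]; push_cast; ring_nf
    _ ≤ |u * X k ω| ^ 2 := by
        rw [norm_mul, norm_expSum, one_mul]
        exact norm_exp_mul_I_sub_taylor_one_le (hux.trans hu)
    _ ≤ _ := pow_le_pow_left₀ (abs_nonneg _) hux 2

lemma norm_expSum_succ_sub_taylor_two_le (hu : |u| * K ≤ 1) (k : ℕ) (ω : Ω) :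
    ‖expSum X u (k + 1) ω - expSum X u k ω - (u * Complex.I) * (X k ω • expSum X u k ω)
      + (u ^ 2 / 2) * ((X k ω * X k ω) • expSum X u k ω)‖ ≤ (|u| * K) ^ 3 := by
  have hux := abs_mul_le_mul_bound hX u k ω
  calc _ = ‖expSum X u k ω * (Complex.exp ((u * X k ω : ℝ) * Complex.I) - 1
        - (u * X k ω : ℝ) * Complex.I + ((u * X k ω : ℝ) : ℂ) ^ 2 / 2)‖ := by
        rw [expSum_succ, Complex.real_smul, Complex.real_smul]; push_cast; ring_nf
    _ ≤ |u * X k ω| ^ 3 := by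
        rw [norm_mul, norm_expSum, one_mul]
        exact norm_exp_mul_I_sub_taylor_two_le (hux.trans hu)
    _ ≤ _ := pow_le_pow_left₀ (abs_nonneg _) hux 3

end ExpSum

section Mixing

lemma sum_range_succ_sub_le_tsum {f : ℕ → ℝ} (hf : ∀ i, 0 ≤ f i) (hs : Summable f) (k : ℕ) :
    ∑ j ∈ Finset.range (k + 1), f (k - j) ≤ ∑' i, f i := by
  rw [Finset.sum_flip]
  exact hs.sum_le_tsum _ fun i _ => hf i

lemma sum_range_sub_le_tsum {f : ℕ → ℝ} (hf : ∀ i, 0 ≤ f i) (hs : Summable f) (k : ℕ) :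
    ∑ j ∈ Finset.range k, f (k - j) ≤ ∑' i, f i := by
  refine le_trans ?_ (sum_range_succ_sub_le_tsum hf hs k)
  rw [Finset.sum_range_succ]
  exact le_add_of_nonneg_right (hf _)

variable {Ω : Type*} {mΩ : MeasurableSpace Ω}

/-- A centered sequence `X` bounded by `K` whose past `F` and future `G` are strongly mixing: `F k`
contains the information of `X 0, …, X k`, `G l` that of `X l, X (l + 1), …`, and the mixing
coefficient of `F k` and `G (k + n)` is at most `b n`. -/
structure IsBoundedMixing (P : Measure Ω) (X : ℕ → Ω → ℝ) (F G : ℕ → MeasurableSpace Ω)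
    (b : ℕ → ℝ) (K : ℝ) : Prop where
  past_le : ∀ k, F k ≤ mΩ
  past_mono : Monotone F
  future_le : ∀ k, G k ≤ mΩ
  future_anti : Antitone G
  mixing : ∀ k l n, k + n ≤ l → ∀ A B, MeasurableSet[F k] A → MeasurableSet[G l] B →
    |P.real (A ∩ B) - P.real A * P.real B| ≤ b n
  measurable_past : ∀ k, Measurable[F k] (X k)
  measurable_future : ∀ k, Measurable[G k] (X k)
  abs_le : ∀ k ω, |X k ω| ≤ K
  integral_eq_zero : ∀ k, ∫ ω, X k ω ∂P = 0

/-- For a centered sequence `X`, the increment `Var (X 0 + ⋯ + X k) - Var (X 0 + ⋯ + X (k - 1))`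
of the variance of the partial sums. -/
noncomputable def varIncr (P : Measure Ω) (X : ℕ → Ω → ℝ) (k : ℕ) : ℝ :=
  ∫ ω, X k ω * X k ω ∂P + 2 * ∑ j ∈ Finset.range k, ∫ ω, X k ω * X j ω ∂P

/-- A bound for the error made in replacing `E[X k X j Y j]` by `E[X k X j] E[Y k]`, where
`Y = expSum X u` and `i = k - j`. The first term separates `X k` from the past of `X j`; the second
one drops the last `r` variables from `Y j`. -/
noncomputable def decouplingBound (b : ℕ → ℝ) (K u : ℝ) (r i : ℕ) : ℝ :=
  min (8 * K ^ 2 * b i) (4 * K ^ 2 * b (r + 1) + K ^ 3 * |u| * (i + 2 * r))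

namespace IsBoundedMixing

variable {P : Measure Ω} {X : ℕ → Ω → ℝ} {F G : ℕ → MeasurableSpace Ω} {b : ℕ → ℝ} {K : ℝ}

lemma coeff_nonneg (h : IsBoundedMixing P X F G b K) (n : ℕ) : 0 ≤ b n :=
  (abs_nonneg _).trans (h.mixing 0 n n (zero_add n).le ∅ ∅ (@MeasurableSet.empty _ (F 0))
    (@MeasurableSet.empty _ (G n)))

lemma measurable (h : IsBoundedMixing P X F G b K) (k : ℕ) : Measurable (X k) :=
  (h.measurable_past k).mono (h.past_le k) le_rfl

lemma measurable_expSum (h : IsBoundedMixing P X F G b K) (u : ℝ) {j k : ℕ} (hjk : j ≤ k + 1) :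
    Measurable[F k] (expSum X u j) :=
  QuenchedCLT.measurable_expSum u fun i hi =>
    (h.measurable_past i).mono (h.past_mono (by omega)) le_rfl

variable [IsProbabilityMeasure P]

lemma bound_nonneg (h : IsBoundedMixing P X F G b K) : 0 ≤ K := by
  obtain ⟨ω⟩ := nonempty_of_isProbabilityMeasure P
  exact (abs_nonneg _).trans (h.abs_le 0 ω)

lemma norm_cov_le {E : Type*} [NormedAddCommGroup E] [NormedSpace ℝ E] [CompleteSpace E]
    (h : IsBoundedMixing P X F G b K) {k l n : ℕ} (hkl : k + n ≤ l) {Y : Ω → E} {Z : Ω → ℝ}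
    {a c : ℝ} (hY : StronglyMeasurable[F k] Y) (hYa : ∀ ω, ‖Y ω‖ ≤ a) (hZ : Measurable[G l] Z)
    (hZc : ∀ ω, |Z ω| ≤ c) :
    ‖∫ ω, Z ω • Y ω ∂P - (∫ ω, Z ω ∂P) • ∫ ω, Y ω ∂P‖ ≤ 4 * a * c * b n :=
  norm_integral_smul_sub_le (h.past_le k) (h.future_le l) (h.mixing k l n hkl) hY hYa
    hZ.stronglyMeasurable hZc

lemma norm_integral_smul_past_le {E : Type*} [NormedAddCommGroup E] [NormedSpace ℝ E]
    [CompleteSpace E] (h : IsBoundedMixing P X F G b K) {j k : ℕ} (hjk : j ≤ k) {Y : Ω → E} {a : ℝ}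
    (hY : StronglyMeasurable[F j] Y) (hYa : ∀ ω, ‖Y ω‖ ≤ a) :
    ‖∫ ω, X k ω • Y ω ∂P‖ ≤ 4 * a * K * b (k - j) := by
  simpa [h.integral_eq_zero] using h.norm_cov_le (Nat.add_sub_of_le hjk).le hY hYa
    (h.measurable_future k) (h.abs_le k)

lemma abs_mul_le (h : IsBoundedMixing P X F G b K) (k j : ℕ) (ω : Ω) : |X k ω * X j ω| ≤ K ^ 2 := by
  rw [abs_mul, sq]
  exact mul_le_mul (h.abs_le k ω) (h.abs_le j ω) (abs_nonneg _) h.bound_nonneg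

lemma integrable_mul (h : IsBoundedMixing P X F G b K) (k j : ℕ) :
    Integrable (fun ω => X k ω * X j ω) P :=
  .of_bound ((h.measurable k).mul (h.measurable j)).aestronglyMeasurable (K ^ 2)
    (ae_of_all _ (h.abs_mul_le k j))

lemma integrable_expSum (h : IsBoundedMixing P X F G b K) (u : ℝ) (k : ℕ) :
    Integrable (expSum X u k) P :=
  .of_bound (QuenchedCLT.measurable_expSum u fun j _ => h.measurable j).aestronglyMeasurable 1
    (ae_of_all _ fun ω => (norm_expSum X u k ω).le)

lemma integrable_smul_expSum (h : IsBoundedMixing P X F G b K) (u : ℝ) (k j : ℕ) :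
    Integrable (fun ω => X k ω • expSum X u j ω) P :=
  (h.integrable_expSum u j).bdd_smul K (h.measurable k).aestronglyMeasurable
    (ae_of_all _ (h.abs_le k))

lemma integrable_mul_smul_expSum (h : IsBoundedMixing P X F G b K) (u : ℝ) (k j i : ℕ) :
    Integrable (fun ω => (X k ω * X j ω) • expSum X u i ω) P :=
  (h.integrable_expSum u i).bdd_smul (K ^ 2)
    ((h.measurable k).mul (h.measurable j)).aestronglyMeasurable (ae_of_all _ (h.abs_mul_le k j))

lemma norm_integral_expSum_le_one (u : ℝ) (k : ℕ) : ‖∫ ω, expSum X u k ω ∂P‖ ≤ 1 := by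
  simpa using norm_integral_le_of_norm_le_const (μ := P)
    (ae_of_all P fun ω => (norm_expSum X u k ω).le)

lemma abs_integral_mul_le (h : IsBoundedMixing P X F G b K) {j k : ℕ} (hjk : j ≤ k) :
    |∫ ω, X k ω * X j ω ∂P| ≤ 4 * K ^ 2 * b (k - j) := by
  calc _ ≤ 4 * K * K * b (k - j) :=
        h.norm_integral_smul_past_le hjk (h.measurable_past j).stronglyMeasurable (h.abs_le j)
    _ = _ := by ring

lemma abs_varIncr_le (h : IsBoundedMixing P X F G b K) (hb : Summable b) (k : ℕ) :
    |varIncr P X k| ≤ 8 * K ^ 2 * ∑' i, b i := by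
  have hcov : ∑ j ∈ Finset.range (k + 1), |∫ ω, X k ω * X j ω ∂P| ≤ 4 * K ^ 2 * ∑' i, b i :=
    calc _ ≤ ∑ j ∈ Finset.range (k + 1), 4 * K ^ 2 * b (k - j) :=
          Finset.sum_le_sum fun j hj => h.abs_integral_mul_le (Finset.mem_range_succ_iff.1 hj)
      _ ≤ _ := by
          rw [← Finset.mul_sum]
          gcongr
          exact sum_range_succ_sub_le_tsum h.coeff_nonneg hb k
  rw [Finset.sum_range_succ] at hcov
  calc |varIncr P X k| ≤ |∫ ω, X k ω * X k ω ∂P|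
        + 2 * ∑ j ∈ Finset.range k, |∫ ω, X k ω * X j ω ∂P| := by
        refine (abs_add_le _ _).trans ?_
        rw [abs_mul, abs_two]
        gcongr
        exact Finset.abs_sum_le_sum_abs _ _
    _ ≤ 8 * K ^ 2 * ∑' i, b i := by linarith [abs_nonneg (∫ ω, X k ω * X k ω ∂P)]

lemma integrable_sum_sq (h : IsBoundedMixing P X F G b K) (n : ℕ) :
    Integrable (fun ω => (∑ k ∈ Finset.range n, X k ω) ^ 2) P := by
  simp only [sq, Finset.sum_mul_sum]
  exact integrable_finsetSum _ fun i _ => integrable_finsetSum _ fun j _ => h.integrable_mul i j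

lemma sum_varIncr (h : IsBoundedMixing P X F G b K) (n : ℕ) :
    ∑ k ∈ Finset.range n, varIncr P X k = ∫ ω, (∑ k ∈ Finset.range n, X k ω) ^ 2 ∂P := by
  induction n with
  | zero => simp
  | succ n ih =>
    have hcross : Integrable (fun ω => ∑ j ∈ Finset.range n, X n ω * X j ω) P :=
      integrable_finsetSum _ fun j _ => h.integrable_mul n j
    have hincr : Integrable
        (fun ω => X n ω * X n ω + 2 * ∑ j ∈ Finset.range n, X n ω * X j ω) P :=
      (h.integrable_mul n n).add (hcross.const_mul 2)
    have hsq : ∀ ω, (∑ k ∈ Finset.range (n + 1), X k ω) ^ 2 = (∑ k ∈ Finset.range n, X k ω) ^ 2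
        + (X n ω * X n ω + 2 * ∑ j ∈ Finset.range n, X n ω * X j ω) := by
      intro ω
      rw [Finset.sum_range_succ, ← Finset.mul_sum]
      ring
    simp only [hsq]
    rw [Finset.sum_range_succ, ih, varIncr, integral_add (h.integrable_sum_sq n) hincr,
      integral_add (h.integrable_mul n n) (hcross.const_mul 2), integral_const_mul,
      integral_finsetSum _ fun j _ => h.integrable_mul n j]

lemma norm_integral_expSum_succ_sub_le (h : IsBoundedMixing P X F G b K) {u : ℝ}
    (hu : |u| * K ≤ 1) (k : ℕ) :
    ‖∫ ω, expSum X u (k + 1) ω ∂P - ∫ ω, expSum X u k ω ∂P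
      - (u * Complex.I) * ∫ ω, X k ω • expSum X u k ω ∂P
      + (u ^ 2 / 2) * ∫ ω, (X k ω * X k ω) • expSum X u k ω ∂P‖ ≤ (|u| * K) ^ 3 := by
  have hincr := (h.integrable_expSum u (k + 1)).sub' (h.integrable_expSum u k)
  have hlin := (h.integrable_smul_expSum u k k).const_mul (u * Complex.I)
  have hquad := (h.integrable_mul_smul_expSum u k k k).const_mul ((u : ℂ) ^ 2 / 2)
  rw [← integral_sub (h.integrable_expSum u _) (h.integrable_expSum u _), ← integral_const_mul,
    ← integral_const_mul, ← integral_sub hincr hlin, ← integral_add (hincr.sub' hlin) hquad]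
  simpa using norm_integral_le_of_norm_le_const (μ := P)
    (ae_of_all _ (norm_expSum_succ_sub_taylor_two_le h.abs_le hu k))

lemma norm_integral_smul_expSum_succ_sub_le (h : IsBoundedMixing P X F G b K) {u : ℝ}
    (hu : |u| * K ≤ 1) {j k : ℕ} (hjk : j ≤ k) :
    ‖∫ ω, X k ω • expSum X u (j + 1) ω ∂P - ∫ ω, X k ω • expSum X u j ω ∂P
      - (u * Complex.I) * ∫ ω, (X k ω * X j ω) • expSum X u j ω ∂P‖
      ≤ 4 * (|u| * K) ^ 2 * K * b (k - j) := by
  have hmeas : Measurable[F j] fun ω => expSum X u (j + 1) ω - expSum X u j ω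
      - (u * Complex.I) * (X j ω • expSum X u j ω) := by
    have hj := h.measurable_expSum u j.le_succ
    exact ((h.measurable_expSum u le_rfl).sub hj).sub (((h.measurable_past j).smul hj).const_mul _)
  have hfactor : ∀ ω, X k ω • expSum X u (j + 1) ω - X k ω • expSum X u j ω
      - (u * Complex.I) * ((X k ω * X j ω) • expSum X u j ω)
      = X k ω • (expSum X u (j + 1) ω - expSum X u j ω
        - (u * Complex.I) * (X j ω • expSum X u j ω)) := fun ω => by
    simp only [smul_sub, mul_smul, mul_smul_comm]
  have hincr := (h.integrable_smul_expSum u k (j + 1)).sub' (h.integrable_smul_expSum u k j)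
  have hlin := (h.integrable_mul_smul_expSum u k j j).const_mul (u * Complex.I)
  rw [← integral_sub (h.integrable_smul_expSum u _ _) (h.integrable_smul_expSum u _ _),
    ← integral_const_mul, ← integral_sub hincr hlin, integral_congr_ae (ae_of_all _ hfactor)]
  exact h.norm_integral_smul_past_le hjk hmeas.stronglyMeasurable
    (norm_expSum_succ_sub_taylor_one_le h.abs_le hu j)

lemma norm_integral_smul_expSum_sub_sum_le (h : IsBoundedMixing P X F G b K) (hb : Summable b)
    {u : ℝ} (hu : |u| * K ≤ 1) (k : ℕ) :
    ‖∫ ω, X k ω • expSum X u k ω ∂P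
      - (u * Complex.I) * ∑ j ∈ Finset.range k, ∫ ω, (X k ω * X j ω) • expSum X u j ω ∂P‖
      ≤ 4 * (|u| * K) ^ 2 * K * ∑' i, b i := by
  have hK := h.bound_nonneg
  have hzero : ∫ ω, X k ω • expSum X u 0 ω ∂P = 0 := by
    simp only [expSum_zero, integral_smul_const, h.integral_eq_zero, zero_smul]
  have htel : ∫ ω, X k ω • expSum X u k ω ∂P = ∑ j ∈ Finset.range k,
      (∫ ω, X k ω • expSum X u (j + 1) ω ∂P - ∫ ω, X k ω • expSum X u j ω ∂P) := by
    rw [Finset.sum_range_sub fun j => ∫ ω, X k ω • expSum X u j ω ∂P, hzero, sub_zero]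
  rw [htel, Finset.mul_sum, ← Finset.sum_sub_distrib]
  calc _ ≤ ∑ j ∈ Finset.range k, 4 * (|u| * K) ^ 2 * K * b (k - j) :=
        norm_sum_le_of_le _ fun j hj =>
          h.norm_integral_smul_expSum_succ_sub_le hu (Finset.mem_range.1 hj).le
    _ ≤ _ := by
        rw [← Finset.mul_sum]
        gcongr
        exact sum_range_sub_le_tsum h.coeff_nonneg hb k

lemma norm_integral_smul_expSum_sub_smul_le (h : IsBoundedMixing P X F G b K) (u : ℝ) {Z : Ω → ℝ}
    {c : ℝ} {j : ℕ} (hZ : Measurable[G j] Z) (hZc : ∀ ω, |Z ω| ≤ c) (r : ℕ) :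
    ‖∫ ω, Z ω • expSum X u (j - r) ω ∂P - (∫ ω, Z ω ∂P) • ∫ ω, expSum X u (j - r) ω ∂P‖
      ≤ 4 * c * b (r + 1) := by
  rcases hi : j - r with _ | i
  · obtain ⟨ω⟩ := nonempty_of_isProbabilityMeasure P
    have hc : 0 ≤ c := (abs_nonneg _).trans (hZc ω)
    have hb := h.coeff_nonneg (r + 1)
    simp only [expSum_zero, integral_smul_const, integral_const, probReal_univ, one_smul, sub_self,
      norm_zero]
    positivity
  · simpa using h.norm_cov_le (by omega : i + (r + 1) ≤ j)
      (h.measurable_expSum u le_rfl).stronglyMeasurable (fun ω => (norm_expSum X u _ ω).le) hZ hZc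

lemma norm_integral_smul_expSum_sub_le (h : IsBoundedMixing P X F G b K) (u : ℝ) {Z : Ω → ℝ}
    {c : ℝ} (hZ : Measurable Z) (hZc : ∀ ω, |Z ω| ≤ c) {i l : ℕ} (hil : i ≤ l) :
    ‖∫ ω, Z ω • expSum X u l ω ∂P - ∫ ω, Z ω • expSum X u i ω ∂P‖
      ≤ c * (|u| * K * (l - i : ℕ)) := by
  have hint : ∀ j, Integrable (fun ω => Z ω • expSum X u j ω) P := fun j =>
    (h.integrable_expSum u j).bdd_smul c hZ.aestronglyMeasurable (ae_of_all _ hZc)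
  rw [← integral_sub (hint l) (hint i)]
  have hpt : ∀ ω, ‖Z ω • expSum X u l ω - Z ω • expSum X u i ω‖
      ≤ c * (|u| * K * (l - i : ℕ)) := fun ω => by
    rw [← smul_sub, norm_smul]
    exact mul_le_mul (hZc ω) (norm_expSum_sub_le h.abs_le u hil ω) (norm_nonneg _)
      ((abs_nonneg _).trans (hZc ω))
  simpa using norm_integral_le_of_norm_le_const (μ := P) (ae_of_all _ hpt)

lemma norm_decoupling_le_of_separation (h : IsBoundedMixing P X F G b K) (u : ℝ) {j k : ℕ}
    (hjk : j ≤ k) :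
    ‖∫ ω, (X k ω * X j ω) • expSum X u j ω ∂P
      - (∫ ω, X k ω * X j ω ∂P) • ∫ ω, expSum X u k ω ∂P‖ ≤ 8 * K ^ 2 * b (k - j) := by
  have hpast : ‖∫ ω, (X k ω * X j ω) • expSum X u j ω ∂P‖ ≤ 4 * K ^ 2 * b (k - j) := by
    have hmeas : Measurable[F j] fun ω => X j ω • expSum X u j ω :=
      (h.measurable_past j).smul (h.measurable_expSum u j.le_succ)
    simp only [mul_smul]
    refine (h.norm_integral_smul_past_le hjk hmeas.stronglyMeasurable (a := K) fun ω => ?_).trans_eq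
      (by ring)
    rw [norm_smul, norm_expSum, mul_one]
    exact h.abs_le j ω
  have hprod : ‖(∫ ω, X k ω * X j ω ∂P) • ∫ ω, expSum X u k ω ∂P‖ ≤ 4 * K ^ 2 * b (k - j) := by
    rw [norm_smul]
    exact (mul_le_of_le_one_right (norm_nonneg _) (norm_integral_expSum_le_one u k)).trans
      (h.abs_integral_mul_le hjk)
  linarith [norm_sub_le (∫ ω, (X k ω * X j ω) • expSum X u j ω ∂P)
    ((∫ ω, X k ω * X j ω ∂P) • ∫ ω, expSum X u k ω ∂P)]

lemma norm_decoupling_le_of_truncation (h : IsBoundedMixing P X F G b K) (u : ℝ) {j k : ℕ}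
    (hjk : j ≤ k) (r : ℕ) :
    ‖∫ ω, (X k ω * X j ω) • expSum X u j ω ∂P
      - (∫ ω, X k ω * X j ω ∂P) • ∫ ω, expSum X u k ω ∂P‖
      ≤ 4 * K ^ 2 * b (r + 1) + K ^ 3 * |u| * ((k - j : ℕ) + 2 * r) := by
  have hK := h.bound_nonneg
  have hdrop : ‖∫ ω, (X k ω * X j ω) • expSum X u j ω ∂P
      - ∫ ω, (X k ω * X j ω) • expSum X u (j - r) ω ∂P‖ ≤ K ^ 2 * (|u| * K * r) := by
    refine (h.norm_integral_smul_expSum_sub_le u ((h.measurable k).mul (h.measurable j))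
      (h.abs_mul_le k j) (Nat.sub_le j r)).trans ?_
    gcongr
    omega
  have hcov := h.norm_integral_smul_expSum_sub_smul_le u
    (((h.measurable_future k).mono (h.future_anti hjk) le_rfl).mul (h.measurable_future j))
    (h.abs_mul_le k j) r
  simp only [Pi.mul_apply] at hcov
  have hrestore : ‖(∫ ω, X k ω * X j ω ∂P) • ∫ ω, expSum X u (j - r) ω ∂P
      - (∫ ω, X k ω * X j ω ∂P) • ∫ ω, expSum X u k ω ∂P‖
      ≤ K ^ 2 * (|u| * K * ((k - j : ℕ) + r)) := by
    rw [← smul_sub, norm_smul, norm_sub_rev]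
    refine mul_le_mul ?_ ?_ (norm_nonneg _) (by positivity)
    · simpa using norm_integral_le_of_norm_le_const (μ := P) (f := fun ω => X k ω * X j ω)
        (ae_of_all P (h.abs_mul_le k j))
    · have hdiff := h.norm_integral_smul_expSum_sub_le u (Z := fun _ => 1) (c := 1)
        measurable_const (by simp) (by omega : j - r ≤ k)
      simp only [one_smul, one_mul] at hdiff
      refine hdiff.trans ?_
      gcongr
      exact_mod_cast (by omega : k - (j - r) ≤ k - j + r)
  linarith [norm_sub_le_norm_sub_add_norm_sub (∫ ω, (X k ω * X j ω) • expSum X u j ω ∂P)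
      (∫ ω, (X k ω * X j ω) • expSum X u (j - r) ω ∂P)
      ((∫ ω, X k ω * X j ω ∂P) • ∫ ω, expSum X u k ω ∂P),
    norm_sub_le_norm_sub_add_norm_sub (∫ ω, (X k ω * X j ω) • expSum X u (j - r) ω ∂P)
      ((∫ ω, X k ω * X j ω ∂P) • ∫ ω, expSum X u (j - r) ω ∂P)
      ((∫ ω, X k ω * X j ω ∂P) • ∫ ω, expSum X u k ω ∂P)]

lemma norm_decoupling_le (h : IsBoundedMixing P X F G b K) (u : ℝ) {j k : ℕ} (hjk : j ≤ k) (r : ℕ) :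
    ‖∫ ω, (X k ω * X j ω) • expSum X u j ω ∂P
      - (∫ ω, X k ω * X j ω ∂P) • ∫ ω, expSum X u k ω ∂P‖ ≤ decouplingBound b K u r (k - j) :=
  le_min (h.norm_decoupling_le_of_separation u hjk) (h.norm_decoupling_le_of_truncation u hjk r)

lemma decouplingBound_nonneg (h : IsBoundedMixing P X F G b K) (u : ℝ) (r i : ℕ) :
    0 ≤ decouplingBound b K u r i := by
  have hK := h.bound_nonneg
  have hi := h.coeff_nonneg i
  have hr := h.coeff_nonneg (r + 1)
  exact le_min (by positivity) (by positivity)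

lemma summable_decouplingBound (h : IsBoundedMixing P X F G b K) (hb : Summable b) (u : ℝ) (r : ℕ) :
    Summable (decouplingBound b K u r) :=
  (hb.mul_left _).of_nonneg_of_le (h.decouplingBound_nonneg u r) fun _ => min_le_left _ _

lemma sum_norm_decoupling_le (h : IsBoundedMixing P X F G b K) (hb : Summable b) (u : ℝ)
    (r k : ℕ) :
    ∑ j ∈ Finset.range (k + 1), ‖∫ ω, (X k ω * X j ω) • expSum X u j ω ∂P
      - (∫ ω, X k ω * X j ω ∂P) • ∫ ω, expSum X u k ω ∂P‖ ≤ ∑' i, decouplingBound b K u r i :=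
  (Finset.sum_le_sum fun _ hj => h.norm_decoupling_le u (Finset.mem_range_succ_iff.1 hj) r).trans
    (sum_range_succ_sub_le_tsum (h.decouplingBound_nonneg u r)
      (h.summable_decouplingBound hb u r) k)

lemma norm_integral_expSum_succ_sub_smul_le (h : IsBoundedMixing P X F G b K) (hb : Summable b)
    {u : ℝ} (hu : |u| * K ≤ 1) (r k : ℕ) :
    ‖∫ ω, expSum X u (k + 1) ω ∂P - (1 - u ^ 2 / 2 * varIncr P X k) • ∫ ω, expSum X u k ω ∂P‖
      ≤ (|u| * K) ^ 3 * (1 + 4 * ∑' i, b i) + u ^ 2 * ∑' i, decouplingBound b K u r i := by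
  set φ := ∫ ω, expSum X u k ω ∂P
  set φ' := ∫ ω, expSum X u (k + 1) ω ∂P
  set A := ∫ ω, X k ω • expSum X u k ω ∂P
  set C : ℕ → ℂ := fun j => ∫ ω, (X k ω * X j ω) • expSum X u j ω ∂P
  set c : ℕ → ℝ := fun j => ∫ ω, X k ω * X j ω ∂P
  have htaylor : ‖φ' - φ - u * Complex.I * A + u ^ 2 / 2 * C k‖ ≤ (|u| * K) ^ 3 :=
    h.norm_integral_expSum_succ_sub_le hu k
  have hpast : ‖u * Complex.I * (A - u * Complex.I * ∑ j ∈ Finset.range k, C j)‖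
      ≤ |u| * (4 * (|u| * K) ^ 2 * K * ∑' i, b i) := by
    rw [norm_mul, norm_mul, Complex.norm_I, mul_one, Complex.norm_real, Real.norm_eq_abs]
    gcongr
    exact h.norm_integral_smul_expSum_sub_sum_le hb hu k
  have hdecoupling : ‖(u ^ 2) • (∑ j ∈ Finset.range k, (C j - c j • φ)
      + (1 / 2 : ℝ) • (C k - c k • φ))‖ ≤ u ^ 2 * ∑' i, decouplingBound b K u r i := by
    rw [norm_smul, Real.norm_of_nonneg (sq_nonneg u)]
    gcongr
    refine le_trans ?_ (h.sum_norm_decoupling_le hb u r k)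
    rw [Finset.sum_range_succ]
    refine (norm_add_le _ _).trans (add_le_add (norm_sum_le _ _) ?_)
    rw [norm_smul]
    exact mul_le_of_le_one_left (norm_nonneg _) (by norm_num)
  have hsplit : φ' - (1 - u ^ 2 / 2 * varIncr P X k) • φ
      = (φ' - φ - u * Complex.I * A + u ^ 2 / 2 * C k)
        + u * Complex.I * (A - u * Complex.I * ∑ j ∈ Finset.range k, C j)
        - (u ^ 2) • (∑ j ∈ Finset.range k, (C j - c j • φ) + (1 / 2 : ℝ) • (C k - c k • φ)) := by
    have hv : varIncr P X k = c k + 2 * ∑ j ∈ Finset.range k, c j := rfl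
    simp only [hv, Finset.sum_sub_distrib, Complex.real_smul, ← Finset.sum_mul]
    push_cast
    linear_combination ((u : ℂ) ^ 2 * ∑ j ∈ Finset.range k, C j) * Complex.I_sq
  rw [hsplit]
  refine (norm_sub_le_of_le (norm_add_le_of_le htaylor hpast) hdecoupling).trans_eq ?_
  ring

end IsBoundedMixing

end Mixing

section Gronwall

variable {E : Type*} [NormedAddCommGroup E] [NormedSpace ℝ E]

lemma norm_exp_smul_sub_le {y z : E} {v a C δ : ℝ} (hy : ‖y‖ ≤ a) (hC : C ≤ 1) (hv : |v| ≤ C)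
    (hz : ‖z - (1 - v) • y‖ ≤ δ) : ‖Real.exp v • z - y‖ ≤ Real.exp v * (δ + C ^ 2 * a) := by
  have hexp : |Real.exp (-v) - 1 - -v| ≤ C ^ 2 := by
    have h := Real.norm_exp_sub_one_sub_id_le (x := -v) (by rw [norm_neg]; exact hv.trans hC)
    rw [norm_neg] at h
    exact h.trans (pow_le_pow_left₀ (abs_nonneg v) hv 2)
  have hfactor : Real.exp v • z - y
      = Real.exp v • (z - (1 - v) • y - (Real.exp (-v) - 1 - -v) • y) := by
    have hinv : Real.exp v * Real.exp (-v) = 1 := by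
      rw [← Real.exp_add, add_neg_cancel, Real.exp_zero]
    match_scalars
    · rfl
    · linear_combination hinv
  rw [hfactor, norm_smul, Real.norm_of_nonneg (Real.exp_pos v).le]
  refine mul_le_mul_of_nonneg_left (norm_sub_le_of_le hz ?_) (Real.exp_pos v).le
  rw [norm_smul]
  exact mul_le_mul hexp hy (norm_nonneg y) (sq_nonneg C)

lemma norm_exp_sum_smul_sub_le {y : ℕ → E} {v : ℕ → ℝ} {a C δ : ℝ} (hy : ∀ k, ‖y k‖ ≤ a)
    (hC : C ≤ 1) (hv : ∀ k, |v k| ≤ C) (hstep : ∀ k, ‖y (k + 1) - (1 - v k) • y k‖ ≤ δ) (N : ℕ) :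
    ‖Real.exp (∑ k ∈ Finset.range N, v k) • y N - y 0‖
      ≤ N * Real.exp (N * C) * (δ + C ^ 2 * a) := by
  have ha : 0 ≤ a := (norm_nonneg _).trans (hy 0)
  have hC0 : 0 ≤ C := (abs_nonneg _).trans (hv 0)
  have hδ : 0 ≤ δ := (norm_nonneg _).trans (hstep 0)
  let z : ℕ → E := fun n => Real.exp (∑ k ∈ Finset.range n, v k) • y n
  have hincr : ∀ n < N, ‖z (n + 1) - z n‖ ≤ Real.exp (N * C) * (δ + C ^ 2 * a) := by
    intro n hn
    have hsum : ∑ k ∈ Finset.range (n + 1), v k ≤ N * C := by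
      calc _ ≤ (n + 1 : ℕ) * C := by
            simpa using Finset.sum_le_card_nsmul (Finset.range (n + 1)) v C
              fun k _ => (le_abs_self _).trans (hv k)
        _ ≤ N * C := by gcongr; exact hn
    calc ‖z (n + 1) - z n‖
        = Real.exp (∑ k ∈ Finset.range n, v k) * ‖Real.exp (v n) • y (n + 1) - y n‖ := by
          simp only [z, Finset.sum_range_succ, Real.exp_add, mul_smul, ← smul_sub]
          rw [norm_smul, Real.norm_of_nonneg (Real.exp_pos _).le]
      _ ≤ Real.exp (∑ k ∈ Finset.range n, v k) * (Real.exp (v n) * (δ + C ^ 2 * a)) := by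
          gcongr
          exact norm_exp_smul_sub_le (hy n) hC (hv n) (hstep n)
      _ = Real.exp (∑ k ∈ Finset.range (n + 1), v k) * (δ + C ^ 2 * a) := by
          rw [Finset.sum_range_succ, Real.exp_add, mul_assoc]
      _ ≤ _ := by gcongr
  calc _ = ‖∑ n ∈ Finset.range N, (z (n + 1) - z n)‖ := by
        rw [Finset.sum_range_sub z]
        simp [z]
    _ ≤ ∑ _n ∈ Finset.range N, Real.exp (N * C) * (δ + C ^ 2 * a) :=
        norm_sum_le_of_le _ fun n hn => hincr n (Finset.mem_range.1 hn)
    _ = _ := by rw [Finset.sum_const, Finset.card_range, nsmul_eq_mul, mul_assoc]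

end Gronwall

section CentralLimit

lemma exists_tendsto_atTop_mul_tendsto_zero {u : ℕ → ℝ} (hu : Tendsto u atTop (𝓝 0)) :
    ∃ r : ℕ → ℕ, Tendsto r atTop atTop ∧ Tendsto (fun n => |u n| * r n) atTop (𝓝 0) := by
  set w : ℕ → ℝ := fun n => √(|u n| + 1 / ((n : ℝ) + 1))
  have hw0 : ∀ n, 0 < w n := fun n => Real.sqrt_pos.2 (by positivity)
  have hw : Tendsto w atTop (𝓝 0) := by
    simpa [w] using (hu.abs.add tendsto_one_div_add_atTop_nhds_zero_nat).sqrt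
  have hw' : Tendsto w atTop (𝓝[>] 0) :=
    tendsto_nhdsWithin_iff.2 ⟨hw, .of_forall hw0⟩
  refine ⟨fun n => ⌊(w n)⁻¹⌋₊, tendsto_nat_floor_atTop.comp (tendsto_inv_nhdsGT_zero.comp hw'),
    squeeze_zero (fun n => by positivity) (fun n => ?_) hw⟩
  calc |u n| * ⌊(w n)⁻¹⌋₊ ≤ w n ^ 2 * (w n)⁻¹ := by
        gcongr
        · rw [Real.sq_sqrt (by positivity)]
          exact le_add_of_nonneg_right (by positivity)
        · exact Nat.floor_le (inv_nonneg.2 (hw0 n).le)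
    _ = w n := by rw [sq, mul_inv_cancel_right₀ (hw0 n).ne']

namespace IsBoundedMixing

variable {Ω : Type*} {mΩ : MeasurableSpace Ω} {P : Measure Ω} [IsProbabilityMeasure P]
  {X : ℕ → Ω → ℝ} {F G : ℕ → MeasurableSpace Ω} {b : ℕ → ℝ} {K : ℝ}

lemma tendsto_tsum_decouplingBound (h : IsBoundedMixing P X F G b K) (hb : Summable b)
    {u : ℕ → ℝ} {r : ℕ → ℕ} (hu : Tendsto u atTop (𝓝 0)) (hr : Tendsto r atTop atTop)
    (hur : Tendsto (fun n => |u n| * r n) atTop (𝓝 0)) :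
    Tendsto (fun n => ∑' i, decouplingBound b K (u n) (r n) i) atTop (𝓝 0) := by
  have hbr : Tendsto (fun n => b (r n + 1)) atTop (𝓝 0) :=
    hb.tendsto_atTop_zero.comp ((tendsto_add_atTop_nat 1).comp hr)
  have hlim : ∀ i : ℕ, Tendsto
      (fun n => 4 * K ^ 2 * b (r n + 1) + K ^ 3 * (|u n| * i + 2 * (|u n| * r n))) atTop (𝓝 0) := by
    intro i
    simpa using (hbr.const_mul (4 * K ^ 2)).add
      (((hu.abs.mul_const (i : ℝ)).add (hur.const_mul 2)).const_mul (K ^ 3))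
  rw [← tsum_zero (α := ℝ) (β := ℕ)]
  refine tendsto_tsum_of_dominated_convergence (hb.mul_left (8 * K ^ 2))
    (fun i => squeeze_zero (fun n => h.decouplingBound_nonneg _ _ i)
      (fun n => (min_le_right _ _).trans_eq ?_) (hlim i)) (.of_forall fun n i => ?_)
  · ring
  · rw [Real.norm_of_nonneg (h.decouplingBound_nonneg _ _ i)]
    exact min_le_left _ _

lemma norm_exp_smul_integral_expSum_sub_one_le (h : IsBoundedMixing P X F G b K) (hb : Summable b)
    {u : ℝ} (hu : |u| * K ≤ 1) (hu' : u ^ 2 * (4 * K ^ 2 * ∑' i, b i) ≤ 1) (r N : ℕ) :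
    ‖Real.exp (u ^ 2 / 2 * ∫ ω, (∑ k ∈ Finset.range N, X k ω) ^ 2 ∂P)
        • ∫ ω, expSum X u N ω ∂P - 1‖
      ≤ N * u ^ 2 * Real.exp (N * u ^ 2 * (4 * K ^ 2 * ∑' i, b i))
        * (|u| * K ^ 3 * (1 + 4 * ∑' i, b i) + ∑' i, decouplingBound b K u r i
          + u ^ 2 * (4 * K ^ 2 * ∑' i, b i) ^ 2) := by
  have hv : ∀ k, |u ^ 2 / 2 * varIncr P X k| ≤ u ^ 2 * (4 * K ^ 2 * ∑' i, b i) := fun k => by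
    rw [abs_mul, abs_of_nonneg (by positivity)]
    linarith [mul_le_mul_of_nonneg_left (h.abs_varIncr_le hb k) (by positivity : 0 ≤ u ^ 2 / 2)]
  have hgronwall := norm_exp_sum_smul_sub_le (norm_integral_expSum_le_one (P := P) (X := X) u) hu'
    hv (h.norm_integral_expSum_succ_sub_smul_le hb hu r) N
  rw [← Finset.mul_sum, h.sum_varIncr] at hgronwall
  simp only [expSum_zero, integral_const, probReal_univ, one_smul] at hgronwall
  refine hgronwall.trans_eq ?_
  rw [mul_pow, pow_succ |u|, sq_abs, ← mul_assoc]
  ring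

theorem tendsto_exp_smul_integral_expSum (h : IsBoundedMixing P X F G b K) (hb : Summable b)
    {N : ℕ → ℕ} {u : ℕ → ℝ} {T : ℝ} (hu : Tendsto u atTop (𝓝 0))
    (hNu : ∀ n, N n * u n ^ 2 ≤ T) :
    Tendsto (fun n => Real.exp (u n ^ 2 / 2 * ∫ ω, (∑ k ∈ Finset.range (N n), X k ω) ^ 2 ∂P)
      • ∫ ω, expSum X (u n) (N n) ω ∂P) atTop (𝓝 1) := by
  obtain ⟨r, hr, hur⟩ := exists_tendsto_atTop_mul_tendsto_zero hu
  set D := 1 + 4 * ∑' i, b i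
  set L := 4 * K ^ 2 * ∑' i, b i
  have hT : 0 ≤ T := (by positivity : 0 ≤ N 0 * u 0 ^ 2).trans (hNu 0)
  have hL0 : 0 ≤ L := mul_nonneg (by positivity) (tsum_nonneg h.coeff_nonneg)
  have hD0 : 0 ≤ D := add_nonneg zero_le_one (mul_nonneg (by norm_num) (tsum_nonneg h.coeff_nonneg))
  have hK := h.bound_nonneg
  have hu1 : ∀ᶠ n in atTop, |u n| * K ≤ 1 := by
    have hlim : Tendsto (fun n => |u n| * K) atTop (𝓝 0) := by simpa using hu.abs.mul_const K
    exact hlim.eventually_le_const one_pos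
  have hu2 : ∀ᶠ n in atTop, u n ^ 2 * L ≤ 1 := by
    have hlim : Tendsto (fun n => u n ^ 2 * L) atTop (𝓝 0) := by simpa using (hu.pow 2).mul_const L
    exact hlim.eventually_le_const one_pos
  have herror : Tendsto (fun n => T * Real.exp (T * L) * (|u n| * K ^ 3 * D
      + ∑' i, decouplingBound b K (u n) (r n) i + u n ^ 2 * L ^ 2)) atTop (𝓝 0) := by
    simpa using ((((hu.abs.mul_const (K ^ 3)).mul_const D).add
      (h.tendsto_tsum_decouplingBound hb hu hr hur)).add
      ((hu.pow 2).mul_const (L ^ 2))).const_mul (T * Real.exp (T * L))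
  rw [tendsto_iff_norm_sub_tendsto_zero]
  refine squeeze_zero' (.of_forall fun n => norm_nonneg _) ?_ herror
  filter_upwards [hu1, hu2] with n h1 h2
  refine (h.norm_exp_smul_integral_expSum_sub_one_le hb h1 h2 (r n) (N n)).trans ?_
  have hdec : 0 ≤ ∑' i, decouplingBound b K (u n) (r n) i :=
    tsum_nonneg (h.decouplingBound_nonneg _ _)
  have hNn := hNu n
  gcongr

lemma tendsto_integral_expSum (h : IsBoundedMixing P X F G b K) (hb : Summable b)
    {N : ℕ → ℕ} {a : ℕ → ℝ} {C v : ℝ} (ha : Tendsto a atTop atTop)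
    (hN : ∀ n, N n ≤ C * a n ^ 2)
    (hv : Tendsto (fun n => (∫ ω, (∑ k ∈ Finset.range (N n), X k ω) ^ 2 ∂P) / a n ^ 2) atTop
      (𝓝 v)) (t : ℝ) :
    Tendsto (fun n => ∫ ω, expSum X (t / a n) (N n) ω ∂P) atTop
      (𝓝 (Real.exp (-(t ^ 2 / 2 * v)) : ℝ)) := by
  have hNu : ∀ n, N n * (t / a n) ^ 2 ≤ |C| * t ^ 2 := fun n => by
    have hNC : N n / a n ^ 2 ≤ |C| := div_le_of_le_mul₀ (sq_nonneg _) (abs_nonneg C)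
      ((hN n).trans (mul_le_mul_of_nonneg_right (le_abs_self C) (sq_nonneg _)))
    calc _ = N n / a n ^ 2 * t ^ 2 := by rw [div_pow]; ring
      _ ≤ _ := by gcongr
  have hcomp := h.tendsto_exp_smul_integral_expSum hb (ha.const_div_atTop t) hNu
  have hvar : ∀ n, (t / a n) ^ 2 / 2 * ∫ ω, (∑ k ∈ Finset.range (N n), X k ω) ^ 2 ∂P
      = t ^ 2 / 2 * ((∫ ω, (∑ k ∈ Finset.range (N n), X k ω) ^ 2 ∂P) / a n ^ 2) := fun n => by
    rw [div_pow]; ring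
  have hexp := (Real.continuous_exp.tendsto _).comp (hv.const_mul (t ^ 2 / 2)).neg
  have hlim := hexp.smul hcomp
  rw [Complex.real_smul, mul_one] at hlim
  refine hlim.congr fun n => ?_
  rw [Function.comp_apply, ← hvar, smul_smul, ← Real.exp_add, neg_add_cancel, Real.exp_zero,
    one_smul]

theorem tendstoInDistribution_gaussianReal (h : IsBoundedMixing P X F G b K) (hb : Summable b)
    {N : ℕ → ℕ} {a : ℕ → ℝ} {C v : ℝ} (ha : Tendsto a atTop atTop)
    (hN : ∀ n, N n ≤ C * a n ^ 2)
    (hv : Tendsto (fun n => (∫ ω, (∑ k ∈ Finset.range (N n), X k ω) ^ 2 ∂P) / a n ^ 2) atTop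
      (𝓝 v)) :
    TendstoInDistribution (fun n ω => (∑ k ∈ Finset.range (N n), X k ω) / a n) atTop id
      (fun _ => P) (gaussianReal 0 v.toNNReal) := by
  have hv0 : 0 ≤ v := ge_of_tendsto' hv fun n =>
    div_nonneg (integral_nonneg fun ω => sq_nonneg _) (sq_nonneg _)
  have hmeas : ∀ n, Measurable fun ω => (∑ k ∈ Finset.range (N n), X k ω) / a n := fun n =>
    (Finset.measurable_fun_sum _ fun k _ => h.measurable k).div_const _
  refine ⟨fun n => (hmeas n).aemeasurable, aemeasurable_id,
    ProbabilityMeasure.tendsto_iff_tendsto_charFun.2 fun t => ?_⟩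
  have hgauss : charFun ((gaussianReal 0 v.toNNReal).map id) t
      = (Real.exp (-(t ^ 2 / 2 * v)) : ℝ) := by
    rw [Measure.map_id, charFun_gaussianReal, Real.coe_toNNReal v hv0]
    push_cast
    ring_nf
  have hcharFun : ∀ n, charFun (P.map fun ω => (∑ k ∈ Finset.range (N n), X k ω) / a n) t
      = ∫ ω, expSum X (t / a n) (N n) ω ∂P := fun n => by
    rw [charFun_apply_real, integral_map (hmeas n).aemeasurable (by fun_prop)]
    congr 1 with ω
    rw [expSum]
    push_cast
    ring_nf
  change Tendsto (fun n => charFun (P.map _) t) atTop (𝓝 (charFun (Measure.map id _) t))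
  simp only [hgauss, hcharFun]
  exact h.tendsto_integral_expSum hb ha hN hv t

end IsBoundedMixing

end CentralLimit

section Averages

lemma tendsto_comp_sub_div {w : ℕ → ℝ} {m : ℝ} (h : Tendsto (fun n : ℕ => w n / n) atTop (𝓝 m))
    (i : ℕ) : Tendsto (fun n : ℕ => w (n - i) / n) atTop (𝓝 m) := by
  rw [← tendsto_add_atTop_iff_nat i]
  have hmul := h.mul (tendsto_natCast_div_add_atTop (i : ℝ))
  rw [mul_one] at hmul
  refine hmul.congr' ?_
  filter_upwards [eventually_ne_atTop 0] with n hn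
  have hn' : (n : ℝ) ≠ 0 := Nat.cast_ne_zero.2 hn
  rw [Nat.add_sub_cancel, Nat.cast_add, div_mul_div_cancel₀ hn']

lemma tendsto_sum_range_div_iff_isLittleO {w : ℕ → ℝ} {m : ℝ} :
    Tendsto (fun n : ℕ => (∑ k ∈ Finset.range n, w k) / n) atTop (𝓝 m)
      ↔ (fun n : ℕ => ∑ k ∈ Finset.range n, (w k - m)) =o[atTop] fun n : ℕ => (n : ℝ) := by
  rw [isLittleO_iff_tendsto' ((eventually_ne_atTop 0).mono fun n hn h =>
    absurd (Nat.cast_eq_zero.1 h) hn), ← tendsto_sub_nhds_zero_iff]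
  refine tendsto_congr' ?_
  filter_upwards [eventually_ne_atTop 0] with n hn
  have hn' : (n : ℝ) ≠ 0 := Nat.cast_ne_zero.2 hn
  rw [Finset.sum_sub_distrib, Finset.sum_const, Finset.card_range, nsmul_eq_mul, sub_div,
    mul_div_cancel_left₀ _ hn']

lemma sum_range_eq_sum_residues {M : Type*} [AddCommMonoid M] (w : ℕ → M) {d : ℕ} (hd : 0 < d)
    (n : ℕ) :
    ∑ k ∈ Finset.range n, w k
      = ∑ r ∈ Finset.range d, ∑ l ∈ Finset.range ((n + (d - 1) - r) / d), w (d * l + r) := by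
  rw [← Finset.sum_fiberwise_of_maps_to (g := (· % d)) (t := Finset.range d)
    fun k _ => Finset.mem_range.2 (Nat.mod_lt k hd)]
  refine Finset.sum_congr rfl fun r hr => ?_
  have hr := Finset.mem_range.1 hr
  have hlt : ∀ l, l < (n + (d - 1) - r) / d ↔ d * l + r < n := fun l => by
    rw [← Nat.succ_le_iff, Nat.le_div_iff_mul_le hd, Nat.succ_mul, mul_comm l d]
    omega
  refine (Finset.sum_nbij' (fun l => d * l + r) (fun k => k / d) ?_ ?_ ?_ ?_ fun _ _ => rfl).symm
  · intro l hl
    simpa [Nat.mod_eq_of_lt hr, ← hlt] using hl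
  · intro k hk
    obtain ⟨hkn, rfl⟩ := Finset.mem_filter.1 hk
    simpa [hlt, Nat.div_add_mod] using hkn
  · intro l _
    simp [Nat.mul_add_div hd, Nat.div_eq_of_lt hr]
  · intro k hk
    obtain ⟨_, rfl⟩ := Finset.mem_filter.1 hk
    exact Nat.div_add_mod k d

lemma tendsto_average_of_residues {w : ℕ → ℝ} {m : ℝ} {d : ℕ} (hd : 0 < d)
    (hlim : ∀ r < d, Tendsto (fun n : ℕ => (∑ l ∈ Finset.range n, w (d * l + r)) / n) atTop (𝓝 m)) :
    Tendsto (fun n : ℕ => (∑ k ∈ Finset.range n, w k) / n) atTop (𝓝 m) := by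
  rw [tendsto_sum_range_div_iff_isLittleO]
  simp only [sum_range_eq_sum_residues (fun k => w k - m) hd]
  refine IsLittleO.fun_sum fun r hr => ?_
  have hr := Finset.mem_range.1 hr
  have hle : ∀ n, (n + (d - 1) - r) / d ≤ n := fun n => by
    have := Nat.le_mul_of_pos_left n hd
    rw [Nat.div_le_iff_le_mul_add_pred hd]
    omega
  have hsize : Tendsto (fun n => (n + (d - 1) - r) / d) atTop atTop :=
    (Nat.tendsto_div_const_atTop hd.ne').comp <| tendsto_atTop_mono
      (fun n => (by omega : n ≤ n + (d - 1) - r)) tendsto_id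
  refine ((tendsto_sum_range_div_iff_isLittleO.1 (hlim r hr)).comp_tendsto hsize).trans_isBigO ?_
  exact IsBigO.of_bound 1 (.of_forall fun n => by simpa using hle n)

lemma sum_triangle_eq {M : Type*} [AddCommMonoid M] (f : ℕ → ℕ → M) (n : ℕ) :
    ∑ k ∈ Finset.range n, ∑ j ∈ Finset.range k, f (k - 1 - j) j
      = ∑ i ∈ Finset.range (n - 1), ∑ j ∈ Finset.range (n - 1 - i), f i j := by
  rw [← Finset.sum_range_diag_flip]
  rcases n with _ | n
  · simp
  rw [Finset.sum_range_succ', Finset.range_zero, Finset.sum_empty, add_zero]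
  refine Finset.sum_congr rfl fun k _ => ?_
  rw [← Finset.sum_range_reflect]
  refine Finset.sum_congr rfl fun j hj => ?_
  have hj := Finset.mem_range.1 hj
  congr 1
  omega

lemma tendsto_average_triangle {f : ℕ → ℕ → ℝ} {B m : ℕ → ℝ} (hB : Summable B)
    (hf : ∀ i j, |f i j| ≤ B i)
    (hlim : ∀ i, Tendsto (fun n : ℕ => (∑ j ∈ Finset.range n, f i j) / n) atTop (𝓝 (m i))) :
    Tendsto (fun n : ℕ => (∑ k ∈ Finset.range n, ∑ j ∈ Finset.range k, f (k - 1 - j) j) / n) atTop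
      (𝓝 (∑' i, m i)) := by
  have hzero : ∀ n, ∀ i ∉ Finset.range (n - 1), ∑ j ∈ Finset.range (n - 1 - i), f i j = 0 := by
    intro n i hi
    rw [Finset.mem_range, not_lt] at hi
    rw [Nat.sub_eq_zero_of_le hi, Finset.range_zero, Finset.sum_empty]
  have htsum : ∀ n, (∑ k ∈ Finset.range n, ∑ j ∈ Finset.range k, f (k - 1 - j) j) / n
      = ∑' i, (∑ j ∈ Finset.range (n - 1 - i), f i j) / n := fun n => by
    rw [sum_triangle_eq, ← tsum_eq_sum (L := .unconditional ℕ) (hzero n), tsum_div_const]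
  simp only [htsum]
  refine tendsto_tsum_of_dominated_convergence hB (fun i => ?_) (.of_forall fun n i => ?_)
  · simpa only [Nat.sub_sub] using tendsto_comp_sub_div (hlim i) (1 + i)
  · rw [norm_div, Real.norm_natCast]
    refine div_le_of_le_mul₀ n.cast_nonneg ((abs_nonneg _).trans (hf i 0)) ?_
    calc _ ≤ ∑ _j ∈ Finset.range (n - 1 - i), B i := norm_sum_le_of_le _ fun j _ => hf i j
      _ = (n - 1 - i : ℕ) * B i := by rw [Finset.sum_const, Finset.card_range, nsmul_eq_mul]
      _ ≤ B i * n := by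
          rw [mul_comm]
          gcongr
          · exact (abs_nonneg _).trans (hf i 0)
          · omega

end Averages

section StrongLaw

variable {Ω : Type*} {mΩ : MeasurableSpace Ω} {Q : Measure Ω}

theorem ae_tendsto_average_of_indepFun_of_add_le {W : ℕ → Ω → ℝ} {d : ℕ} (hd : 0 < d)
    (hint : Integrable (W 0) Q) (hindep : ∀ i j, i + d ≤ j → IndepFun (W i) (W j) Q)
    (hident : ∀ i, IdentDistrib (W i) (W 0) Q Q) :
    ∀ᵐ ω ∂Q, Tendsto (fun n : ℕ => (∑ k ∈ Finset.range n, W k ω) / n) atTop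
      (𝓝 (∫ ω, W 0 ω ∂Q)) := by
  have hresidue : ∀ r, ∀ᵐ ω ∂Q, Tendsto
      (fun n : ℕ => (∑ l ∈ Finset.range n, W (d * l + r) ω) / n) atTop (𝓝 (∫ ω, W 0 ω ∂Q)) := by
    intro r
    have hlt : ∀ i j, i < j → IndepFun (W (d * i + r)) (W (d * j + r)) Q := fun i j hij => by
      have := Nat.mul_le_mul_left d (Nat.succ_le_of_lt hij)
      rw [Nat.mul_succ] at this
      exact hindep _ _ (by omega)
    rw [← (hident (d * 0 + r)).integral_eq]
    exact strong_law_ae_real (fun l => W (d * l + r)) ((hident _).integrable_iff.2 hint)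
      (fun i j hij => hij.lt_or_gt.elim (hlt i j) fun h => (hlt j i h).symm)
      fun l => (hident _).trans (hident _).symm
  filter_upwards [ae_all_iff.2 hresidue] with ω hω
  exact tendsto_average_of_residues hd fun r _ => hω r

variable {S : Type*} [MeasurableSpace S] {μ : Measure S} {Y : ℕ → Ω → S}

lemma integrable_comp_of_hasLaw {Z : Ω → S} (hZ : HasLaw Z μ Q) {f : S → ℝ}
    (hf : Integrable f μ) : Integrable (f ∘ Z) Q := by
  rw [← hZ.map_eq] at hf
  exact hf.comp_aemeasurable hZ.aemeasurable

theorem ae_tendsto_average_comp (hY : ∀ j, HasLaw (Y j) μ Q) (hindep : iIndepFun Y Q) {f : S → ℝ}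
    (hf : Measurable f) (hfi : Integrable f μ) :
    ∀ᵐ ω ∂Q, Tendsto (fun n : ℕ => (∑ j ∈ Finset.range n, f (Y j ω)) / n) atTop
      (𝓝 (∫ y, f y ∂μ)) := by
  rw [← (hY 0).integral_comp hf.aestronglyMeasurable]
  exact strong_law_ae_real (fun j => f ∘ Y j) (integrable_comp_of_hasLaw (hY 0) hfi)
    (fun i j hij => (hindep.indepFun hij).comp hf hf) fun j => ((hY j).identDistrib (hY 0)).comp hf

theorem ae_tendsto_average_comp_prodMk (hY : ∀ j, HasLaw (Y j) μ Q) (hindep : iIndepFun Y Q)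
    {f : S × S → ℝ} (hf : Measurable f) (hfi : Integrable f (μ.prod μ)) {i : ℕ} (hi : 0 < i) :
    ∀ᵐ ω ∂Q, Tendsto (fun n : ℕ => (∑ j ∈ Finset.range n, f (Y j ω, Y (j + i) ω)) / n) atTop
      (𝓝 (∫ z, f z ∂μ.prod μ)) := by
  have hlaw : ∀ j, HasLaw (fun ω => (Y j ω, Y (j + i) ω)) (μ.prod μ) Q := fun j =>
    have := hindep.isProbabilityMeasure
    (hindep.indepFun (by omega)).hasLaw_prod (hY j) (hY (j + i))
  rw [← (hlaw 0).integral_comp hf.aestronglyMeasurable]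
  refine ae_tendsto_average_of_indepFun_of_add_le (W := fun j => f ∘ fun ω => (Y j ω, Y (j + i) ω))
    i.succ_pos (integrable_comp_of_hasLaw (hlaw 0) hfi) (fun j k hjk => ?_)
    fun j => ((hlaw j).identDistrib (hlaw 0)).comp hf
  exact (hindep.indepFun_prodMk_prodMk₀ (fun j => (hY j).aemeasurable) _ _ _ _ (by omega) (by omega)
    (by omega) (by omega)).comp hf hf

end StrongLaw

section RandomField

variable {Ω S : Type*} {mΩ : MeasurableSpace Ω} [MeasurableSpace S]

/-- A random field `X` indexed by a time in `ℕ` and a parameter in `S`, such that every sequence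
`X 0 (s 0), X 1 (s 1), …` is centered, bounded and mixing, and whose covariances are stationary
in time: `c i (y, z)` is the covariance of `X j y` and `X (j + i) z` for every `j`. -/
structure IsStationaryMixingField (P : Measure Ω) (X : ℕ → S → Ω → ℝ) (F G : ℕ → MeasurableSpace Ω)
    (b : ℕ → ℝ) (K : ℝ) (c : ℕ → S × S → ℝ) : Prop where
  isBoundedMixing : ∀ s : ℕ → S, IsBoundedMixing P (fun k => X k (s k)) F G b K
  measurable_cov : ∀ i, Measurable (c i)
  integral_mul : ∀ i j y z, ∫ ω, X (j + i) z ω * X j y ω ∂P = c i (y, z)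

/-- The limit of `Var (X 0 (s 0) + ⋯ + X (n - 1) (s (n - 1))) / n` for a field `X` with covariances
`c` and typical samples `s` of independent parameters with law `μ`. -/
noncomputable def limitVariance (μ : Measure S) (c : ℕ → S × S → ℝ) : ℝ :=
  ∫ y, c 0 (y, y) ∂μ + 2 * ∑' i, ∫ z, c (i + 1) z ∂μ.prod μ

lemma hasLaw_eval_infinitePi {μ : Measure S} [IsProbabilityMeasure μ] (j : ℕ) :
    HasLaw (fun s : ℕ → S => s j) μ (Measure.infinitePi fun _ : ℕ => μ) :=
  (measurePreserving_eval_infinitePi (fun _ => μ) j).hasLaw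

lemma iIndepFun_eval_infinitePi {μ : Measure S} [IsProbabilityMeasure μ] :
    iIndepFun (fun (j : ℕ) (s : ℕ → S) => s j) (Measure.infinitePi fun _ : ℕ => μ) :=
  iIndepFun_infinitePi (X := fun _ => id) fun _ => measurable_id

namespace IsStationaryMixingField

variable {P : Measure Ω} {X : ℕ → S → Ω → ℝ} {F G : ℕ → MeasurableSpace Ω} {b : ℕ → ℝ} {K : ℝ}
  {c : ℕ → S × S → ℝ}

lemma varIncr_eq (h : IsStationaryMixingField P X F G b K c) (s : ℕ → S) (k : ℕ) :
    varIncr P (fun k => X k (s k)) k = c 0 (s k, s k)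
      + 2 * ∑ j ∈ Finset.range k, c (k - 1 - j + 1) (s j, s (j + (k - 1 - j + 1))) := by
  have hdiag := h.integral_mul 0 k (s k) (s k)
  rw [add_zero] at hdiag
  rw [varIncr, hdiag]
  congr 2
  refine Finset.sum_congr rfl fun j hj => ?_
  have hj := Finset.mem_range.1 hj
  rw [← h.integral_mul, (by omega : j + (k - 1 - j + 1) = k)]

variable [IsProbabilityMeasure P]

lemma abs_cov_le (h : IsStationaryMixingField P X F G b K c) (s : ℕ → S) (j i : ℕ) :
    |c i (s j, s (j + i))| ≤ 4 * K ^ 2 * b i := by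
  simpa [h.integral_mul] using (h.isBoundedMixing s).abs_integral_mul_le (j.le_add_right i)

lemma abs_cov_zero_le (h : IsStationaryMixingField P X F G b K c) (y : S) :
    |c 0 (y, y)| ≤ 4 * K ^ 2 * b 0 :=
  h.abs_cov_le (fun _ => y) 0 0

lemma abs_cov_succ_le (h : IsStationaryMixingField P X F G b K c) (i : ℕ) (z : S × S) :
    |c (i + 1) z| ≤ 4 * K ^ 2 * b (i + 1) := by
  simpa using h.abs_cov_le (fun j => if j = 0 then z.1 else z.2) 0 (i + 1)

variable {μ : Measure S} [IsProbabilityMeasure μ]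

lemma integrable_cov_zero (h : IsStationaryMixingField P X F G b K c) :
    Integrable (fun y => c 0 (y, y)) μ :=
  .of_bound ((h.measurable_cov 0).comp (by fun_prop)).aestronglyMeasurable _
    (ae_of_all _ h.abs_cov_zero_le)

lemma integrable_cov_succ (h : IsStationaryMixingField P X F G b K c) (i : ℕ) :
    Integrable (c (i + 1)) (μ.prod μ) :=
  .of_bound (h.measurable_cov _).aestronglyMeasurable _ (ae_of_all _ (h.abs_cov_succ_le i))

lemma summable_integral_cov (h : IsStationaryMixingField P X F G b K c) (hb : Summable b) :
    Summable fun i => ∫ z, c (i + 1) z ∂μ.prod μ := by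
  refine .of_norm_bounded (((summable_nat_add_iff 1).2 hb).mul_left (4 * K ^ 2)) fun i => ?_
  simpa using norm_integral_le_of_norm_le_const (μ := μ.prod μ) (f := c (i + 1))
    (ae_of_all _ (h.abs_cov_succ_le i))

section Sampling

variable {Ω' : Type*} {mΩ' : MeasurableSpace Ω'} {Q : Measure Ω'} {Y : ℕ → Ω' → S}

theorem ae_tendsto_variance_div (h : IsStationaryMixingField P X F G b K c) (hb : Summable b)
    (hY : ∀ j, HasLaw (Y j) μ Q) (hindep : iIndepFun Y Q) :
    ∀ᵐ ω' ∂Q, Tendsto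
      (fun n : ℕ => (∫ ω, (∑ k ∈ Finset.range n, X k (Y k ω') ω) ^ 2 ∂P) / n) atTop
      (𝓝 (limitVariance μ c)) := by
  have hdiag := ae_tendsto_average_comp hY hindep ((h.measurable_cov 0).comp (by fun_prop))
    h.integrable_cov_zero
  have hoff : ∀ i, _ := fun i => ae_tendsto_average_comp_prodMk hY hindep
    (h.measurable_cov (i + 1)) (h.integrable_cov_succ i) i.succ_pos
  filter_upwards [hdiag, ae_all_iff.2 hoff] with ω' hω₀ hω
  have htriangle := tendsto_average_triangle
    (((summable_nat_add_iff 1).2 hb).mul_left (4 * K ^ 2))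
    (fun i j => h.abs_cov_succ_le i (Y j ω', Y (j + (i + 1)) ω')) hω
  refine (hω₀.add (htriangle.const_mul 2)).congr fun n => ?_
  rw [← (h.isBoundedMixing fun k => Y k ω').sum_varIncr]
  simp only [h.varIncr_eq, Finset.sum_add_distrib, ← Finset.mul_sum, add_div, mul_div_assoc,
    Function.comp_apply]

theorem ae_tendstoInDistribution (h : IsStationaryMixingField P X F G b K c) (hb : Summable b)
    (hY : ∀ j, HasLaw (Y j) μ Q) (hindep : iIndepFun Y Q) (i : ℕ) :
    ∀ᵐ ω' ∂Q, TendstoInDistribution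
      (fun n ω => (∑ k ∈ Finset.range (n - i), X k (Y k ω') ω) / √n) atTop id (fun _ => P)
      (gaussianReal 0 (limitVariance μ c).toNNReal) := by
  filter_upwards [h.ae_tendsto_variance_div hb hY hindep] with ω' hω'
  refine (h.isBoundedMixing fun k => Y k ω').tendstoInDistribution_gaussianReal hb (C := 1)
    (Real.tendsto_sqrt_atTop.comp tendsto_natCast_atTop_atTop) (fun n => ?_) ?_
  · rw [Real.sq_sqrt n.cast_nonneg, one_mul]
    exact_mod_cast n.sub_le i
  · simp only [Real.sq_sqrt (Nat.cast_nonneg _)]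
    exact tendsto_comp_sub_div hω' i

end Sampling

lemma limitVariance_nonneg (h : IsStationaryMixingField P X F G b K c) (hb : Summable b) :
    0 ≤ limitVariance μ c := by
  obtain ⟨s, hs⟩ := (h.ae_tendsto_variance_div hb (hasLaw_eval_infinitePi (μ := μ))
    iIndepFun_eval_infinitePi).exists
  exact ge_of_tendsto' hs fun n => div_nonneg (integral_nonneg fun ω => sq_nonneg _) n.cast_nonneg

end IsStationaryMixingField

end RandomField

lemma tendstoInDistribution_comp_tendsto {ι κ Ω' E : Type*} {Ω : ι → Type*}
    [∀ i, MeasurableSpace (Ω i)] [MeasurableSpace Ω'] [TopologicalSpace E] [MeasurableSpace E]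
    [OpensMeasurableSpace E] {P : ∀ i, Measure (Ω i)} [∀ i, IsProbabilityMeasure (P i)]
    {Q : Measure Ω'} [IsProbabilityMeasure Q] {X : ∀ i, Ω i → E} {Z : Ω' → E} {l : Filter ι}
    {l' : Filter κ} {φ : κ → ι} (h : TendstoInDistribution X l Z P Q) (hφ : Tendsto φ l' l) :
    TendstoInDistribution (fun k => X (φ k)) l' Z (fun k => P (φ k)) Q where
  forall_aemeasurable k := h.forall_aemeasurable (φ k)
  aemeasurable_limit := h.aemeasurable_limit
  tendsto := h.tendsto.comp hφ

section Centered

variable {ν μ : Measure ℝ≥0} [IsProbabilityMeasure ν] {g : ℝ≥0 × ℝ≥0 → ℝ} {C : ℝ}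

lemma measurable_centered (hg : Measurable g) : Measurable (centered ν g) := by
  have hmean : StronglyMeasurable fun y : ℝ≥0 => ∫ v, g (v, y) ∂ν :=
    (hg.comp measurable_swap).stronglyMeasurable.integral_prod_right'
  exact hg.sub (hmean.measurable.comp measurable_snd)

lemma abs_centered_le (hC : ∀ z, |g z| ≤ C) (z : ℝ≥0 × ℝ≥0) : |centered ν g z| ≤ 2 * C := by
  have hmean : |∫ v, g (v, z.2) ∂ν| ≤ C := by
    simpa using norm_integral_le_of_norm_le_const (μ := ν) (f := fun v => g (v, z.2))
      (ae_of_all ν fun v => hC _)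
  rw [centered, two_mul]
  exact (abs_sub _ _).trans (add_le_add (hC z) hmean)

lemma integral_centered (hg : Measurable g) (hC : ∀ z, |g z| ≤ C) (y : ℝ≥0) :
    ∫ x, centered ν g (x, y) ∂ν = 0 := by
  have hint : Integrable (fun x => g (x, y)) ν :=
    .of_bound (hg.comp (by fun_prop)).aestronglyMeasurable C (ae_of_all _ fun x => hC _)
  simp only [centered]
  rw [integral_sub hint (integrable_const _), integral_const, probReal_univ, one_smul, sub_self]

lemma integrable_centered_sq [IsProbabilityMeasure μ] (hg : Measurable g) (hC : ∀ z, |g z| ≤ C) :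
    Integrable (fun z => centered ν g z ^ 2) (ν.prod μ) := by
  refine .of_bound ((measurable_centered hg).pow_const 2).aestronglyMeasurable ((2 * C) ^ 2)
    (ae_of_all _ fun z => ?_)
  rw [norm_pow]
  exact pow_le_pow_left₀ (norm_nonneg _) (abs_centered_le hC z) 2

end Centered

section MixingCoefficients

variable {Ω : Type*}

lemma pastSigma_mono (ξ : ℕ → Ω → ℝ≥0) : Monotone (pastSigma ξ) :=
  fun _ _ h => biSup_mono fun _ hi => ⟨hi.1, hi.2.trans h⟩

lemma futureSigma_anti (ξ : ℕ → Ω → ℝ≥0) : Antitone (futureSigma ξ) :=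
  fun _ _ h => biSup_mono fun _ hi => h.trans hi

lemma measurable_pastSigma (ξ : ℕ → Ω → ℝ≥0) {k : ℕ} (hk : 1 ≤ k) :
    Measurable[pastSigma ξ k] (ξ k) :=
  measurable_iff_comap_le.2 (le_iSup₂_of_le k ⟨hk, le_rfl⟩ le_rfl)

lemma measurable_futureSigma (ξ : ℕ → Ω → ℝ≥0) (k : ℕ) : Measurable[futureSigma ξ k] (ξ k) :=
  measurable_iff_comap_le.2 (le_iSup₂_of_le k (Set.mem_Ici.2 le_rfl) le_rfl)

variable [MeasurableSpace Ω] {P : Measure Ω} [IsProbabilityMeasure P]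

lemma abs_measureReal_inter_sub_mul_le_one (A B : Set Ω) :
    |P.real (A ∩ B) - P.real A * P.real B| ≤ 1 :=
  abs_sub_le_of_nonneg_of_le measureReal_nonneg measureReal_le_one
    (mul_nonneg measureReal_nonneg measureReal_nonneg)
    (mul_le_one₀ measureReal_le_one measureReal_nonneg measureReal_le_one)

lemma abs_measureReal_inter_sub_mul_le_alpha {ξ : ℕ → Ω → ℝ≥0} {k l n : ℕ} (hk : 1 ≤ k)
    (hkl : k + n ≤ l) {A B : Set Ω} (hA : MeasurableSet[pastSigma ξ k] A)
    (hB : MeasurableSet[futureSigma ξ l] B) :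
    |P.real (A ∩ B) - P.real A * P.real B| ≤ alpha P ξ n := by
  refine le_csSup ⟨1, ?_⟩ ⟨k, hk, A, B, hA, futureSigma_anti ξ hkl _ hB, rfl⟩
  rintro _ ⟨_, _, _, _, _, _, rfl⟩
  exact abs_measureReal_inter_sub_mul_le_one _ _

end MixingCoefficients

section Stationary

variable {Ω : Type*} {mΩ : MeasurableSpace Ω} {P : Measure Ω} {ν μ : Measure ℝ≥0}
  {ξ : ℕ → Ω → ℝ≥0} {g : ℝ≥0 × ℝ≥0 → ℝ} {C : ℝ}

/-- The covariance of `g̃ (ξ 1, y)` and `g̃ (ξ (1 + i), z)`, as a function of `(y, z)`. -/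
noncomputable def lagCov (P : Measure Ω) (ν : Measure ℝ≥0) (ξ : ℕ → Ω → ℝ≥0)
    (g : ℝ≥0 × ℝ≥0 → ℝ) (i : ℕ) (x : ℝ≥0 × ℝ≥0) : ℝ :=
  ∫ ω, centered ν g (ξ 1 ω, x.1) * centered ν g (ξ (1 + i) ω, x.2) ∂P

namespace IsPairStationary

lemma map_prodMk_eq (h : IsPairStationary P ν ξ) (i j : ℕ) :
    P.map (fun ω => (ξ (j + 1) ω, ξ (j + i + 1) ω)) = P.map fun ω => (ξ 1 ω, ξ (1 + i) ω) := by
  rcases j.eq_zero_or_pos with rfl | hj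
  · simp only [zero_add, add_comm]
  · rw [h.pair_law_eq 1 (1 + i) j le_rfl (by omega) hj]
    simp only [(by omega : 1 + j = j + 1), (by omega : 1 + i + j = j + i + 1)]

variable [IsProbabilityMeasure ν]

lemma measurable_corrVar (h : IsPairStationary P ν ξ) (hg : Measurable g) (i : ℕ) :
    Measurable (corrVar ν ξ g i) := by
  have hξ := h.measurable 1 le_rfl
  have hξi := h.measurable (1 + i) (by omega)
  have hcentered := measurable_centered (ν := ν) hg
  exact (hcentered.comp (by fun_prop)).mul (hcentered.comp (by fun_prop))

lemma integral_mul_eq_lagCov (h : IsPairStationary P ν ξ) (hg : Measurable g) (i j : ℕ)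
    (y z : ℝ≥0) :
    ∫ ω, centered ν g (ξ (j + i + 1) ω, z) * centered ν g (ξ (j + 1) ω, y) ∂P
      = lagCov P ν ξ g i (y, z) := by
  let f : ℝ≥0 × ℝ≥0 → ℝ := fun x => centered ν g (x.1, y) * centered ν g (x.2, z)
  have hf : Measurable f := by
    have hcentered := measurable_centered (ν := ν) hg
    exact (hcentered.comp (by fun_prop)).mul (hcentered.comp (by fun_prop))
  have hpair : ∀ k l, 1 ≤ k → 1 ≤ l →
      ∫ x, f x ∂P.map (fun ω => (ξ k ω, ξ l ω)) = ∫ ω, f (ξ k ω, ξ l ω) ∂P := fun k l hk hl =>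
    integral_map ((h.measurable k hk).prodMk (h.measurable l hl)).aemeasurable
      hf.aestronglyMeasurable
  calc _ = ∫ ω, f (ξ (j + 1) ω, ξ (j + i + 1) ω) ∂P := by simp only [f, mul_comm]
    _ = ∫ ω, f (ξ 1 ω, ξ (1 + i) ω) ∂P := by
      rw [← hpair _ _ (by omega) (by omega), h.map_prodMk_eq, hpair _ _ le_rfl (by omega)]

lemma integral_centered_sq_eq [IsProbabilityMeasure μ] (h : IsPairStationary P ν ξ)
    (hg : Measurable g) (hC : ∀ z, |g z| ≤ C) :
    ∫ z, centered ν g z ^ 2 ∂ν.prod μ = ∫ y, lagCov P ν ξ g 0 (y, y) ∂μ := by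
  rw [integral_prod_symm _ (integrable_centered_sq hg hC)]
  congr 1 with y
  have hsq : Measurable fun x => centered ν g (x, y) ^ 2 :=
    ((measurable_centered hg).comp (by fun_prop)).pow_const 2
  have hlaw : HasLaw (ξ 1) ν P := ⟨(h.measurable 1 le_rfl).aemeasurable, h.law_eq 1 le_rfl⟩
  rw [lagCov, ← hlaw.integral_comp hsq.aestronglyMeasurable]
  simp only [Function.comp_apply, sq, add_zero]

variable [IsProbabilityMeasure P]

lemma measurable_lagCov (h : IsPairStationary P ν ξ) (hg : Measurable g) (i : ℕ) :
    Measurable (lagCov P ν ξ g i) :=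
  (StronglyMeasurable.integral_prod_left' (μ := P)
    (h.measurable_corrVar hg i).stronglyMeasurable).measurable

lemma integrable_corrVar [IsProbabilityMeasure μ] (h : IsPairStationary P ν ξ) (hg : Measurable g)
    (hC : ∀ z, |g z| ≤ C) (i : ℕ) : Integrable (corrVar ν ξ g i) (P.prod (μ.prod μ)) := by
  refine .of_bound (h.measurable_corrVar hg i).aestronglyMeasurable (2 * C * (2 * C))
    (ae_of_all _ fun w => ?_)
  rw [corrVar, norm_mul]
  exact mul_le_mul (abs_centered_le hC _) (abs_centered_le hC _) (norm_nonneg _)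
    ((abs_nonneg _).trans (abs_centered_le (ν := ν) hC (0, 0)))

lemma corr_eq_integral_lagCov [IsProbabilityMeasure μ] (h : IsPairStationary P ν ξ)
    (hg : Measurable g) (hC : ∀ z, |g z| ≤ C) (i : ℕ) :
    corr P ν μ ξ g i = ∫ z, lagCov P ν ξ g i z ∂μ.prod μ :=
  integral_prod_symm _ (h.integrable_corrVar hg hC i)

lemma rhoSq_eq_limitVariance [IsProbabilityMeasure μ] (h : IsPairStationary P ν ξ)
    (hg : Measurable g) (hC : ∀ z, |g z| ≤ C) :
    rhoSq P ν μ ξ g = limitVariance μ (lagCov P ν ξ g) := by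
  simp only [rhoSq, limitVariance, h.integral_centered_sq_eq hg hC,
    h.corr_eq_integral_lagCov hg hC]

lemma isBoundedMixing_centered (h : IsPairStationary P ν ξ) (hg : Measurable g)
    (hC : ∀ z, |g z| ≤ C) (s : ℕ → ℝ≥0) :
    IsBoundedMixing P (fun k ω => centered ν g (ξ (k + 1) ω, s k)) (fun k => pastSigma ξ (k + 1))
      (fun k => futureSigma ξ (k + 1)) (alpha P ξ) (2 * C) where
  past_le _ := iSup₂_le fun i hi => (h.measurable i hi.1).comap_le
  past_mono _ _ hkl := pastSigma_mono ξ (Nat.add_le_add_right hkl 1)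
  future_le k := iSup₂_le fun i hi => (h.measurable i ((Nat.le_add_left 1 k).trans hi)).comap_le
  future_anti _ _ hkl := futureSigma_anti ξ (Nat.add_le_add_right hkl 1)
  mixing k l n hkl A B := abs_measureReal_inter_sub_mul_le_alpha (by omega) (by omega)
  measurable_past k := (measurable_centered hg).comp
    ((measurable_pastSigma ξ (by omega)).prodMk measurable_const)
  measurable_future k := (measurable_centered hg).comp
    ((measurable_futureSigma ξ _).prodMk measurable_const)
  abs_le _ _ := abs_centered_le hC _
  integral_eq_zero k := by
    have hlaw : HasLaw (ξ (k + 1)) ν P :=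
      ⟨(h.measurable _ (by omega)).aemeasurable, h.law_eq _ (by omega)⟩
    have hmeas : Measurable fun x => centered ν g (x, s k) :=
      (measurable_centered hg).comp (by fun_prop)
    rw [← integral_centered (ν := ν) hg hC (s k), ← hlaw.integral_comp hmeas.aestronglyMeasurable]
    rfl

lemma isStationaryMixingField_centered (h : IsPairStationary P ν ξ) (hg : Measurable g)
    (hC : ∀ z, |g z| ≤ C) :
    IsStationaryMixingField P (fun k y ω => centered ν g (ξ (k + 1) ω, y))
      (fun k => pastSigma ξ (k + 1)) (fun k => futureSigma ξ (k + 1)) (alpha P ξ) (2 * C)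
      (lagCov P ν ξ g) where
  isBoundedMixing := h.isBoundedMixing_centered hg hC
  measurable_cov := h.measurable_lagCov hg
  integral_mul := h.integral_mul_eq_lagCov hg

lemma ae_tendstoInDistribution [IsProbabilityMeasure μ] (h : IsPairStationary P ν ξ)
    (hmix : Summable (alpha P ξ)) (hg : Measurable g) (hC : ∀ z, |g z| ≤ C) :
    ∀ᵐ s ∂(Measure.infinitePi fun _ : ℕ => μ), TendstoInDistribution
      (fun (n : ℕ) ω => (∑ j ∈ Finset.Icc 1 (n - 1), centered ν g (ξ j ω, s j)) / √n) atTop id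
      (fun _ => P) (gaussianReal 0 (rhoSq P ν μ ξ g).toNNReal) := by
  have hIcc : ∀ (f : ℕ → ℝ) n, ∑ j ∈ Finset.Icc 1 n, f j = ∑ k ∈ Finset.range n, f (k + 1) :=
    fun f n => by
      rw [Finset.range_eq_Ico, Finset.sum_Ico_add' f, zero_add, ← Finset.Ico_add_one_right_eq_Icc]
  simp only [hIcc, h.rhoSq_eq_limitVariance hg hC]
  exact (h.isStationaryMixingField_centered hg hC).ae_tendstoInDistribution hmix
    (Y := fun j (s : ℕ → ℝ≥0) => s (j + 1)) (fun j => hasLaw_eval_infinitePi (j + 1))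
    (iIndepFun_eval_infinitePi.precomp (add_left_injective 1)) 1

end IsPairStationary

end Stationary

end QuenchedCLT

theorem theorem3_general {Ω : Type*} [MeasurableSpace Ω] (P : Measure Ω) [IsProbabilityMeasure P]
    (ν μ : Measure ℝ≥0) [IsProbabilityMeasure ν] [IsProbabilityMeasure μ]
    (ξ : ℕ → Ω → ℝ≥0)
    (hstat : QuenchedCLT.IsPairStationary P ν ξ)
    (hmix : Summable (fun n : ℕ => QuenchedCLT.alpha P ξ (n + 1)))
    (g : ℝ≥0 × ℝ≥0 → ℝ) (hg : Measurable g) (hbdd : ∃ C : ℝ, ∀ z, |g z| ≤ C) :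
    Integrable (fun z => QuenchedCLT.centered ν g z ^ 2) (ν.prod μ) ∧
    (∀ k : ℕ, 1 ≤ k → Integrable (QuenchedCLT.corrVar ν ξ g k) (P.prod (μ.prod μ))) ∧
    Summable (fun k : ℕ => QuenchedCLT.corr P ν μ ξ g (k + 1)) ∧
    0 ≤ QuenchedCLT.rhoSq P ν μ ξ g ∧
    ∀ᵐ s ∂(Measure.infinitePi (fun _ : ℕ => μ)),
      TendstoInDistribution
        (fun (n : ℕ) (ω : Ω) =>
          (∑ j ∈ Finset.Icc 1 (2 * n - 1), QuenchedCLT.centered ν g (ξ j ω, s j)) /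
            √(2 * (n : ℝ)))
        atTop (id : ℝ → ℝ) (fun _ => P)
        (gaussianReal 0 (QuenchedCLT.rhoSq P ν μ ξ g).toNNReal) := by
  obtain ⟨C, hC⟩ := hbdd
  have hsum : Summable (QuenchedCLT.alpha P ξ) := (summable_nat_add_iff 1).1 hmix
  have hfield := hstat.isStationaryMixingField_centered hg hC
  refine ⟨QuenchedCLT.integrable_centered_sq hg hC, fun k _ => hstat.integrable_corrVar hg hC k,
    ?summable, ?nonneg, ?clt⟩
  case summable =>
    simpa only [hstat.corr_eq_integral_lagCov hg hC] using hfield.summable_integral_cov hsum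
  case nonneg =>
    rw [hstat.rhoSq_eq_limitVariance hg hC]
    exact hfield.limitVariance_nonneg hsum
  case clt =>
    have hdouble : Tendsto (fun n : ℕ => 2 * n) atTop atTop :=
      tendsto_id.const_mul_atTop' two_pos
    filter_upwards [hstat.ae_tendstoInDistribution hsum hg hC] with s hs
    simpa only [Nat.cast_mul, Nat.cast_ofNat] using
      QuenchedCLT.tendstoInDistribution_comp_tendsto hs hdouble

theorem theorem3 {Ω : Type*} [MeasurableSpace Ω] (P : Measure Ω) [IsProbabilityMeasure P]
    (ν μ : Measure ℝ≥0) [IsProbabilityMeasure ν] [IsProbabilityMeasure μ]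
    (ξ : ℕ → Ω → ℝ≥0)
    (hstat : QuenchedCLT.IsPairStationary P ν ξ)
    (hmix : Summable (fun n : ℕ => QuenchedCLT.alpha P ξ (n + 1)))
    (hblocks : ∃ p q : ℕ → ℕ, QuenchedCLT.IsBlockPair (QuenchedCLT.alpha P ξ) p q)
    (g : ℝ≥0 × ℝ≥0 → ℝ) (hg : Measurable g) (hbdd : ∃ C : ℝ, ∀ z, |g z| ≤ C) :
    -- the limiting variance is well defined and finite (and nonnegative)
    Integrable (fun z => QuenchedCLT.centered ν g z ^ 2) (ν.prod μ) ∧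
    (∀ k : ℕ, 1 ≤ k → Integrable (QuenchedCLT.corrVar ν ξ g k) (P.prod (μ.prod μ))) ∧
    Summable (fun k : ℕ => QuenchedCLT.corr P ν μ ξ g (k + 1)) ∧
    0 ≤ QuenchedCLT.rhoSq P ν μ ξ g ∧
    -- the quenched central limit theorem
    ∀ᵐ s ∂(Measure.infinitePi (fun _ : ℕ => μ)),
      TendstoInDistribution
        (fun (n : ℕ) (ω : Ω) =>
          (∑ j ∈ Finset.Icc 1 (2 * n - 1), QuenchedCLT.centered ν g (ξ j ω, s j)) /
            √(2 * (n : ℝ)))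
        atTop (id : ℝ → ℝ) (fun _ => P)
        (gaussianReal 0 (QuenchedCLT.rhoSq P ν μ ξ g).toNNReal) :=
  theorem3_general P ν μ ξ hstat hmix g hg hbdd
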